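/- \textbf{Conventions.} All spaces are pointed, $[\,\cdot\,,\cdot\,]$ denotes pointed homotopy classes of pointed maps, products and smash products are formed with the compactly generated topology, $\Sigma$ is the reduced suspension, and $[\Sigma W,X]$ carries the group structure given by the suspension comultiplication $\nu:\Sigma W\to\Sigma W\vee\Sigma W$, here written multiplicatively; $(x,y)=xyx^{-1}y^{-1}$ and $x^{y}=yxy^{-1}$. $\Sigma W$ is homotopy co-commutative if $T\circ\nu\simeq\nu$ for the interchange map $T$. For a space $W$ let $\tau_W(X)=[\Sigma(W\sqcup *),X]$. For $\xi\in[\Sigma A,X]$, $\eta\in[\Sigma B,X]$ the generalized Whitehead product $[\xi,\eta]\in[\Sigma(A\wedge B),X]$ is the class whose pullback along $\Sigma(A\times B)\to\Sigma(A\wedge B)$ is the commutator $\big((\Sigma p_A)^*\xi,(\Sigma p_B)^*\eta\big)$. Let $A\wedge B\wedge C$ be the quotient of $A\times B\times C$ by the fat wedge; an iterated product $[[\xi,\eta],\zeta]$ is regarded as an element of $[\Sigma(A\wedge B\wedge C),X]$ through the natural map $A\wedge B\wedge C\to(A\wedge B)\wedge C$, and it has an image $\overline{[[\xi,\eta],\zeta]}\in\tau_{A\times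 B\times C}(X)$ through $(A\times B\times C)\sqcup *\to A\times B\times C\to A\wedge B\wedge C$. Let $t_{213}(a,b,c)=(b,a,c)$, $t_{321}(a,b,c)=(c,b,a)$, $t_{132}(a,b,c)=(a,c,b)$, $t_{312}(a,b,c)=(c,a,b)$, $t_{231}(a,b,c)=(b,c,a)$, on products, products with a disjoint base point, and smash products. \textbf{Theorem.} Let $A,B,C$ be pointed spaces, each of the pointed homotopy type of a well-pointed compactly generated Hausdorff space, let $X$ be a pointed space, and let $\alpha\in[\Sigma A,X]$, $\beta\in[\Sigma B,X]$, $\gamma\in[\Sigma C,X]$, with images $\bar\alpha,\bar\beta,\bar\gamma\in\tau_{A\times B\times C}(X)$ under the projections of $A\times B\times C$. Then the generalized Whitehead products below, and the action of $\pi_1(X)$ in (3), exist and are unique, and: (1) In $\tau_{A\times B\times C}(X)$, $$\big((\Sigma t_{213})^*\overline{[[\beta^{-1},\alpha],\gamma]}\big)^{\bar\beta}\cdot\big((\Sigma t_{321})^*\overline{[[\gamma^{-1},\beta],\alpha]}\big)^{\bar\gamma}\cdot\big((\Sigma t_{132})^*\overline{[[\alpha^{-1},\gamma],\beta]}\big)^{\bar\alpha}=1,$$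 and the three elements that are conjugated here are the iterated commutators $((\bar\beta^{-1},\bar\alpha),\bar\gamma)$, $((\bar\gamma^{-1},\bar\beta),\bar\alpha)$ and $((\bar\alpha^{-1},\bar\gamma),\bar\beta)$. (2) If $\Sigma A,\Sigma B,\Sigma C$ are homotopy co-commutative, then in $[\Sigma(A\wedge B\wedge C),X]$ $$[[\alpha,\beta],\gamma]\cdot(\Sigma t_{312})^*[[\gamma,\alpha],\beta]\cdot(\Sigma t_{231})^*[[\beta,\gamma],\alpha]=1.$$ (3) If each of $A,B,C$ has a homotopy co-commutative suspension or is $S^0$ (up to pointed homotopy equivalence; so that its suspension is $S^1$), then in $[\Sigma(A\wedge B\wedge C),X]$ $$(\Sigma t_{213})^*\big(\beta\cdot[[\beta^{-1},\alpha],\gamma]\big)\;(\Sigma t_{321})^*\big(\gamma\cdot[[\gamma^{-1},\beta],\alpha]\big)\;(\Sigma t_{132})^*\big(\alpha\cdot[[\alpha^{-1},\gamma],\beta]\big)=1,$$ where, for $\xi\in[\Sigma V,X]$ with $V\in\{A,B,C\}$ and $\eta\in[\Sigma W,X]$, $\xi\cdot\eta=\eta$ if $V\not\simeq S^0$, while if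 $V\simeq S^0$, so that $\xi\in[\Sigma S^0,X]=\pi_1(X)$, $\xi\cdot\eta=\eta^{\xi}$ is the classical action of $\pi_1(X)$ on $[\Sigma W,X]$, i.e. the element of $[\Sigma W,X]$ whose image in $\tau_W(X)\cong[\Sigma W,X]\rtimes\pi_1(X)$ is the conjugate by $\xi$ of the image of $\eta$. -/

import Mathlib

universe u v w

noncomputable section

namespace Jacobi

open Topology unitInterval

/-! Pointed spaces, pointed maps, pointed homotopy classes -/

/-- A pointed topological space. -/
structure PSpace : Type (u + 1) where
  /-- the underlying set -/
  carrier : Type u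
  /-- its topology -/
  top : TopologicalSpace carrier
  /-- the base point -/
  pt : carrier

instance : CoeSort PSpace.{u} (Type u) := ⟨PSpace.carrier⟩

instance (A : PSpace.{u}) : TopologicalSpace A := A.top

/-- A pointed (base point preserving, continuous) map. -/
structure PMap (A : PSpace.{u}) (X : PSpace.{v}) where
  /-- the underlying continuous map -/
  toMap : C(A, X)
  map_pt : toMap A.pt = X.pt

namespace PMap

/-- The identity map. -/
def id (A : PSpace.{u}) : PMap A A := ⟨ContinuousMap.id A, rfl⟩

/-- The constant map at the base point. -/
def const (A : PSpace.{u}) (X : PSpace.{v}) : PMap A X := ⟨ContinuousMap.const A X.pt, rfl⟩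

/-- The composite `g ∘ f`. -/
def comp {A : PSpace.{u}} {B : PSpace.{v}} {X : PSpace.{w}} (g : PMap B X) (f : PMap A B) :
    PMap A X :=
  ⟨g.toMap.comp f.toMap, by simp [f.map_pt, g.map_pt]⟩

/-- Pointed homotopy: homotopy relative to the base point. -/
def Homotopic {A : PSpace.{u}} {X : PSpace.{v}} (f g : PMap A X) : Prop :=
  f.toMap.HomotopicRel g.toMap {A.pt}

/-- Pointed homotopy is an equivalence relation. -/
instance setoid (A : PSpace.{u}) (X : PSpace.{v}) : Setoid (PMap A X) where
  r := Homotopic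
  iseqv := ⟨fun _ => ContinuousMap.HomotopicRel.refl _, fun h => h.symm, fun h k => h.trans k⟩

theorem Homotopic.postcomp {A : PSpace.{u}} {B : PSpace.{v}} {X : PSpace.{w}} {f g : PMap A B}
    (h : f.Homotopic g) (k : PMap B X) : (k.comp f).Homotopic (k.comp g) :=
  ContinuousMap.HomotopicRel.comp_continuousMap h k.toMap

theorem Homotopic.precomp {A : PSpace.{u}} {B : PSpace.{v}} {X : PSpace.{w}} {f g : PMap B X}
    (h : f.Homotopic g) (k : PMap A B) : (f.comp k).Homotopic (g.comp k) := by
  obtain ⟨H⟩ := h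
  refine ⟨⟨⟨⟨fun p => H (p.1, k.toMap p.2), by fun_prop⟩, ?_, ?_⟩, ?_⟩⟩
  · intro x; simp [comp]
  · intro x; simp [comp]
  · rintro t x rfl
    have := H.eq_fst t (x := B.pt) rfl
    simpa [comp, k.map_pt] using this

end PMap

/-- A pointed homotopy equivalence. -/
def IsHEquiv {A : PSpace.{u}} {B : PSpace.{v}} (f : PMap A B) : Prop :=
  ∃ g : PMap B A, (g.comp f).Homotopic (PMap.id A) ∧ (f.comp g).Homotopic (PMap.id B)

/-- The set `[A, X]` of pointed homotopy classes of pointed maps. -/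
def HClass (A : PSpace.{u}) (X : PSpace.{v}) : Type (max u v) := Quotient (PMap.setoid A X)

/-- The function `f^* : [B, X] → [A, X]` induced by a pointed map `f : A → B`. -/
def HClass.pull {A : PSpace.{u}} {B : PSpace.{v}} {X : PSpace.{w}} (f : PMap A B) :
    HClass B X → HClass A X :=
  Quotient.map (fun g => g.comp f) fun _ _ h => PMap.Homotopic.precomp h f

/-! Collapsing a subspace to a point -/

/-- The quotient space `A / S` in which the subset `S` (containing the base point in every use
below) is collapsed to one point, the base point. -/
def collapse (A : PSpace.{u}) (S : Set A) : PSpace.{u} where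
  carrier := Quot fun x y : A => x ∈ S ∧ y ∈ S
  top := inferInstance
  pt := Quot.mk _ A.pt

/-- The projection `A → A / S`. -/
def collapse.mk (A : PSpace.{u}) (S : Set A) : PMap A (collapse A S) :=
  ⟨⟨Quot.mk _, continuous_quot_mk⟩, rfl⟩

/-- The pointed map `A / S → X` induced by a pointed map `A → X` that is trivial on `S`. -/
def collapse.lift {A : PSpace.{u}} {S : Set A} {X : PSpace.{v}} (f : PMap A X)
    (hf : ∀ x ∈ S, f.toMap x = X.pt) : PMap (collapse A S) X :=
  ⟨⟨Quot.lift f.toMap fun x y h => (hf x h.1).trans (hf y h.2).symm,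
    continuous_quot_lift _ f.toMap.continuous⟩, f.map_pt⟩

theorem collapse.lift_homotopic {A : PSpace.{u}} {S : Set A} {X : PSpace.{v}} {f g : PMap A X}
    (hf : ∀ x ∈ S, f.toMap x = X.pt) (hg : ∀ x ∈ S, g.toMap x = X.pt)
    (H : f.toMap.HomotopyRel g.toMap (insert A.pt S)) :
    (collapse.lift f hf).Homotopic (collapse.lift g hg) := by
  have hH : ∀ t, ∀ x ∈ S, H (t, x) = X.pt := fun t x hx =>
    (H.eq_fst t (Set.mem_insert_of_mem _ hx)).trans (hf x hx)
  let K : I × collapse A S → X := fun p =>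
    Quot.lift (fun x => H (p.1, x)) (fun x y h => (hH _ x h.1).trans (hH _ y h.2).symm) p.2
  have hq : IsQuotientMap (collapse.mk A S).toMap := isQuotientMap_quot_mk
  have hK : Continuous K := by
    refine hq.continuous_lift_prod_right ?_
    exact H.continuous
  refine ⟨⟨⟨⟨K, hK⟩, ?_, ?_⟩, ?_⟩⟩
  · rintro ⟨x⟩; exact H.apply_zero x
  · rintro ⟨x⟩; exact H.apply_one x
  · rintro t x rfl
    exact H.eq_fst t (Set.mem_insert _ _)

/-! Wedges -/

/-- The disjoint union, with the base point of the first summand. -/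
def psum (A B : PSpace.{u}) : PSpace.{u} where
  carrier := A.carrier ⊕ B.carrier
  top := inferInstance
  pt := Sum.inl A.pt

/-- The wedge `A ∨ B`. -/
def wedge (A B : PSpace.{u}) : PSpace.{u} :=
  collapse (psum A B) {x | x = Sum.inl A.pt ∨ x = Sum.inr B.pt}

namespace wedge

/-- The inclusion `A → A ∨ B`. -/
def inl (A B : PSpace.{u}) : PMap A (wedge A B) :=
  ⟨(collapse.mk (psum A B) _).toMap.comp ⟨(Sum.inl : A.carrier → A.carrier ⊕ B.carrier),
    continuous_inl⟩, rfl⟩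

/-- The inclusion `B → A ∨ B`. -/
def inr (A B : PSpace.{u}) : PMap B (wedge A B) :=
  ⟨(collapse.mk (psum A B) _).toMap.comp ⟨(Sum.inr : B.carrier → A.carrier ⊕ B.carrier),
    continuous_inr⟩, Quot.sound ⟨Or.inr rfl, Or.inl rfl⟩⟩

/-- The map of the disjoint union given by `f` and `g`. -/
def sumElim {A B : PSpace.{u}} {X : PSpace.{v}} (f : PMap A X) (g : PMap B X) :
    PMap (psum A B) X :=
  ⟨⟨(Sum.elim f.toMap g.toMap : A.carrier ⊕ B.carrier → X),
    f.toMap.continuous.sumElim g.toMap.continuous⟩, f.map_pt⟩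

theorem sumElim_pt {A B : PSpace.{u}} {X : PSpace.{v}} (f : PMap A X) (g : PMap B X) :
    ∀ x ∈ {x : psum A B | x = Sum.inl A.pt ∨ x = Sum.inr B.pt},
      (sumElim f g).toMap x = X.pt := by
  rintro x (rfl | rfl)
  · exact f.map_pt
  · exact g.map_pt

/-- The map `A ∨ B → X` which is `f` on `A` and `g` on `B`. -/
def desc {A B : PSpace.{u}} {X : PSpace.{v}} (f : PMap A X) (g : PMap B X) :
    PMap (wedge A B) X :=
  collapse.lift (sumElim f g) (sumElim_pt f g)

theorem desc_homotopic {A B : PSpace.{u}} {X : PSpace.{v}} {f f' : PMap A X} {g g' : PMap B X}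
    (hf : f.Homotopic f') (hg : g.Homotopic g') : (desc f g).Homotopic (desc f' g') := by
  obtain ⟨F⟩ := hf
  obtain ⟨G⟩ := hg
  let H : I × (A.carrier ⊕ B.carrier) → X :=
    fun p => Sum.elim (fun a => F (p.1, a)) (fun b => G (p.1, b)) p.2
  have hH : Continuous H := by
    have h : Continuous (H ∘ (Homeomorph.prodSumDistrib (X := I) (Y := A) (Z := B)).symm) := by
      rw [continuous_sum_dom]
      exact ⟨F.continuous, G.continuous⟩
    simpa [Function.comp_assoc] using h.comp (Homeomorph.prodSumDistrib (X := I)).continuous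
  refine collapse.lift_homotopic _ _ ⟨⟨⟨H, hH⟩, ?_, ?_⟩, ?_⟩
  · rintro (a | b)
    · exact F.apply_zero a
    · exact G.apply_zero b
  · rintro (a | b)
    · exact F.apply_one a
    · exact G.apply_one b
  · rintro t x (rfl | rfl | rfl)
    · exact F.eq_fst t rfl
    · exact F.eq_fst t rfl
    · exact G.eq_fst t rfl

/-- The interchange map `T : A ∨ A → A ∨ A`. -/
def swap (A : PSpace.{u}) : PMap (wedge A A) (wedge A A) := desc (inr A A) (inl A A)

end wedge

/-! Reduced suspensions -/

/-- The cylinder `A × [0,1]`. -/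
def cyl (A : PSpace.{u}) : PSpace.{u} where
  carrier := A.carrier × I
  top := inferInstance
  pt := (A.pt, 0)

/-- The part of the cylinder that is collapsed in the reduced suspension. -/
def suspEnds (A : PSpace.{u}) : Set (cyl A) :=
  {p : A.carrier × I | p.1 = A.pt ∨ p.2 = 0 ∨ p.2 = 1}

/-- The reduced suspension `ΣA`. -/
def Susp (A : PSpace.{u}) : PSpace.{u} := collapse (cyl A) (suspEnds A)

namespace Susp

/-- The point `[a, t]` of `ΣA`. -/
def mk {A : PSpace.{u}} (a : A) (t : I) : Susp A := (collapse.mk (cyl A) (suspEnds A)).toMap (a, t)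

theorem continuous_mk (A : PSpace.{u}) : Continuous fun p : A × I => mk p.1 p.2 :=
  (collapse.mk (cyl A) (suspEnds A)).toMap.continuous

theorem mk_eq_pt {A : PSpace.{u}} {a : A} {t : I} (h : a = A.pt ∨ t = 0 ∨ t = 1) :
    mk a t = (Susp A).pt :=
  Quot.sound ⟨h, Or.inl rfl⟩

/-- `Σf`, given by `[a, t] ↦ [f a, t]`. -/
def map {A B : PSpace.{u}} (f : PMap A B) : PMap (Susp A) (Susp B) :=
  collapse.lift (A := cyl A) (S := suspEnds A) (X := Susp B)
    ⟨⟨fun p : A × I => mk (f.toMap p.1) p.2, (continuous_mk B).comp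
      ((f.toMap.continuous.comp continuous_fst).prodMk continuous_snd)⟩,
      mk_eq_pt (Or.inl f.map_pt)⟩ (by
    rintro ⟨a, t⟩ (h | h)
    · exact mk_eq_pt (Or.inl (by rw [show a = A.pt from h]; exact f.map_pt))
    · exact mk_eq_pt (Or.inr h))

/-- The inversion `[a, t] ↦ [a, 1 - t]` of `ΣA`. -/
def rev (A : PSpace.{u}) : PMap (Susp A) (Susp A) :=
  collapse.lift (A := cyl A) (S := suspEnds A) (X := Susp A)
    ⟨⟨fun p : A × I => mk p.1 (σ p.2), (continuous_mk A).comp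
      (continuous_fst.prodMk (unitInterval.continuous_symm.comp continuous_snd))⟩,
      mk_eq_pt (Or.inl rfl)⟩ (by
    rintro ⟨a, t⟩ (h | h | h)
    · exact mk_eq_pt (Or.inl h)
    · exact mk_eq_pt (Or.inr (Or.inr (by rw [show t = 0 from h]; exact unitInterval.symm_zero)))
    · exact mk_eq_pt (Or.inr (Or.inl (by rw [show t = 1 from h]; exact unitInterval.symm_one))))

/-- The comultiplication on the cylinder: `(a, t)` goes to `[a, 2t]` in the first copy of `ΣA`
if `t ≤ 1/2`, and to `[a, 2t - 1]` in the second copy otherwise. -/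
def comultFun (A : PSpace.{u}) (p : A × I) : wedge (Susp A) (Susp A) :=
  if (p.2 : ℝ) ≤ 1 / 2 then
    (wedge.inl (Susp A) (Susp A)).toMap (mk p.1 (Set.projIcc 0 1 zero_le_one (2 * (p.2 : ℝ))))
  else
    (wedge.inr (Susp A) (Susp A)).toMap (mk p.1 (Set.projIcc 0 1 zero_le_one (2 * (p.2 : ℝ) - 1)))

theorem continuous_comultFun (A : PSpace.{u}) : Continuous (comultFun A) := by
  unfold comultFun
  refine Continuous.if_le ?_ ?_ (by fun_prop) continuous_const ?_
  · have h : Continuous fun p : A × I =>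
        (p.1, Set.projIcc (0 : ℝ) 1 zero_le_one (2 * (p.2 : ℝ))) := by fun_prop
    exact (wedge.inl (Susp A) (Susp A)).toMap.continuous.comp ((continuous_mk A).comp h)
  · have h : Continuous fun p : A × I =>
        (p.1, Set.projIcc (0 : ℝ) 1 zero_le_one (2 * (p.2 : ℝ) - 1)) := by fun_prop
    exact (wedge.inr (Susp A) (Susp A)).toMap.continuous.comp ((continuous_mk A).comp h)
  · rintro ⟨a, t⟩ h
    have h' : (t : ℝ) = 1 / 2 := h
    rw [mk_eq_pt (Or.inr (Or.inr ?_)), mk_eq_pt (Or.inr (Or.inl ?_)), PMap.map_pt, PMap.map_pt]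
    · exact Set.projIcc_of_le_left _ (by simp [h'])
    · exact Set.projIcc_of_right_le _ (by simp [h'])

theorem comultFun_pt {A : PSpace.{u}} (p : A × I) (h : p ∈ suspEnds A) :
    comultFun A p = (wedge (Susp A) (Susp A)).pt := by
  obtain ⟨a, t⟩ := p
  unfold comultFun
  split_ifs with ht
  · rw [mk_eq_pt, PMap.map_pt]
    rcases h with h | h | h
    · exact Or.inl h
    · refine Or.inr (Or.inl (Set.projIcc_of_le_left _ ?_))
      simp [show t = 0 from h]
    · norm_num [show t = 1 from h] at ht
  · rw [mk_eq_pt, PMap.map_pt]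
    rcases h with h | h | h
    · exact Or.inl h
    · norm_num [show t = 0 from h] at ht
    · refine Or.inr (Or.inr (Set.projIcc_of_right_le _ ?_))
      norm_num [show t = 1 from h]

/-- The suspension comultiplication `ν : ΣA → ΣA ∨ ΣA`. -/
def comult (A : PSpace.{u}) : PMap (Susp A) (wedge (Susp A) (Susp A)) :=
  collapse.lift (A := cyl A) (S := suspEnds A)
    ⟨⟨comultFun A, continuous_comultFun A⟩, comultFun_pt (A.pt, 0) (Or.inl rfl)⟩ comultFun_pt

/-- `ΣA` is homotopy co-commutative: `T ∘ ν` and `ν` are homotopic. -/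
def CoCommutative (A : PSpace.{u}) : Prop :=
  ((wedge.swap (Susp A)).comp (comult A)).Homotopic (comult A)

end Susp

/-! The group operations on `[ΣA, X]`, written multiplicatively -/

section Group

variable {A : PSpace.{u}} {X : PSpace.{v}}

/-- The product of the classes of `f` and `g` is the class of `(f, g) ∘ ν`. -/
instance : Mul (HClass (Susp A) X) :=
  ⟨Quotient.map₂ (fun f g => (wedge.desc f g).comp (Susp.comult A)) fun _ _ hf _ _ hg =>
    (wedge.desc_homotopic hf hg).precomp _⟩

/-- The inverse of a class is its composite with the inversion of `ΣA`. -/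
instance : Inv (HClass (Susp A) X) := ⟨HClass.pull (Susp.rev A)⟩

/-- The neutral element is the class of the constant map. -/
instance : One (HClass (Susp A) X) := ⟨Quotient.mk _ (PMap.const _ _)⟩

/-- The commutator `(x, y) = x y x⁻¹ y⁻¹`. -/
def comm (x y : HClass (Susp A) X) : HClass (Susp A) X := x * y * x⁻¹ * y⁻¹

/-- The conjugate `x^y = y x y⁻¹`. -/
def conj (x y : HClass (Susp A) X) : HClass (Susp A) X := y * x * y⁻¹

end Group

/-! Products and smash products, in the sense of compactly generated spaces -/

/-- The product `A × B` with the compactly generated topology. -/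
def kprod (A B : PSpace.{u}) : PSpace.{u} where
  carrier := A.carrier × B.carrier
  top := TopologicalSpace.compactlyGenerated.{u} (A.carrier × B.carrier)
  pt := (A.pt, B.pt)

namespace kprod

/-- The identity function from the product with its compactly generated topology to the product
with its product topology. -/
def toProd (A B : PSpace.{u}) : kprod A B → A.carrier × B.carrier := fun p => p

/-- The inverse of `toProd`. -/
def ofProd (A B : PSpace.{u}) : A.carrier × B.carrier → kprod A B := fun p => p

theorem continuous_toProd (A B : PSpace.{u}) : Continuous (toProd A B) :=
  continuous_from_compactlyGenerated (X := A.carrier × B.carrier) (toProd A B)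
    fun _ g => g.continuous

theorem continuous_ofProd_comp {A B : PSpace.{u}} (S : CompHaus.{u})
    (g : C(S, A.carrier × B.carrier)) : Continuous (ofProd A B ∘ g) := by
  refine continuous_def.2 fun s hs => ?_
  have h := isOpen_sigma_iff.1 (isOpen_coinduced.1 hs)
  exact h ⟨S, g⟩

/-- The projection `A × B → A`. -/
def fst (A B : PSpace.{u}) : PMap (kprod A B) A :=
  ⟨⟨fun p => (toProd A B p).1, continuous_fst.comp (continuous_toProd A B)⟩, rfl⟩

/-- The projection `A × B → B`. -/
def snd (A B : PSpace.{u}) : PMap (kprod A B) B :=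
  ⟨⟨fun p => (toProd A B p).2, continuous_snd.comp (continuous_toProd A B)⟩, rfl⟩

/-- The map `(f, g)` from a product `D × E` to a product `A × B`. -/
def pair {D E A B : PSpace.{u}} (f : PMap (kprod D E) A) (g : PMap (kprod D E) B) :
    PMap (kprod D E) (kprod A B) :=
  ⟨⟨fun p => ofProd A B (f.toMap p, g.toMap p), by
    refine continuous_from_compactlyGenerated (X := D.carrier × E.carrier) _ fun S k => ?_
    have hk := continuous_ofProd_comp (A := D) (B := E) S k
    exact continuous_ofProd_comp S
      ⟨fun s => (f.toMap (ofProd D E (k s)), g.toMap (ofProd D E (k s))),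
        (f.toMap.continuous.comp hk).prodMk (g.toMap.continuous.comp hk)⟩⟩,
    Prod.ext f.map_pt g.map_pt⟩

end kprod

/-- The smash product `A ∧ B = (A × B) / (A ∨ B)`. -/
def smash (A B : PSpace.{u}) : PSpace.{u} :=
  collapse (kprod A B) {p : A.carrier × B.carrier | p.1 = A.pt ∨ p.2 = B.pt}

/-- The projection `A × B → A ∧ B`. -/
def smash.proj (A B : PSpace.{u}) : PMap (kprod A B) (smash A B) := collapse.mk _ _

/-- The product `A × B × C`. -/
abbrev kprod3 (A B C : PSpace.{u}) : PSpace.{u} := kprod (kprod A B) C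

namespace kprod3

variable (A B C : PSpace.{u})

/-- The projection to the first factor. -/
def p1 : PMap (kprod3 A B C) A := (kprod.fst A B).comp (kprod.fst (kprod A B) C)

/-- The projection to the second factor. -/
def p2 : PMap (kprod3 A B C) B := (kprod.snd A B).comp (kprod.fst (kprod A B) C)

/-- The projection to the third factor. -/
def p3 : PMap (kprod3 A B C) C := kprod.snd (kprod A B) C

/-- The map to a triple product with given components. -/
def triple {A B C D E F : PSpace.{u}} (f : PMap (kprod3 A B C) D) (g : PMap (kprod3 A B C) E)
    (h : PMap (kprod3 A B C) F) : PMap (kprod3 A B C) (kprod3 D E F) :=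
  kprod.pair (kprod.pair f g) h

/-- The twisting function `(a, b, c) ↦ (b, a, c)`. -/
def t213 : PMap (kprod3 A B C) (kprod3 B A C) := triple (p2 A B C) (p1 A B C) (p3 A B C)

/-- The twisting function `(a, b, c) ↦ (c, b, a)`. -/
def t321 : PMap (kprod3 A B C) (kprod3 C B A) := triple (p3 A B C) (p2 A B C) (p1 A B C)

/-- The twisting function `(a, b, c) ↦ (a, c, b)`. -/
def t132 : PMap (kprod3 A B C) (kprod3 A C B) := triple (p1 A B C) (p3 A B C) (p2 A B C)

/-- The twisting function `(a, b, c) ↦ (c, a, b)`. -/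
def t312 : PMap (kprod3 A B C) (kprod3 C A B) := triple (p3 A B C) (p1 A B C) (p2 A B C)

/-- The twisting function `(a, b, c) ↦ (b, c, a)`. -/
def t231 : PMap (kprod3 A B C) (kprod3 B C A) := triple (p2 A B C) (p3 A B C) (p1 A B C)

end kprod3

/-- The points of `A × B × C` that have a coordinate at the base point. -/
def fatWedge (A B C : PSpace.{u}) : Set (kprod3 A B C) :=
  {p : (A.carrier × B.carrier) × C.carrier | p.1.1 = A.pt ∨ p.1.2 = B.pt ∨ p.2 = C.pt}

/-- The smash product `A ∧ B ∧ C`, the quotient of `A × B × C` by the fat wedge. -/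
def smash3 (A B C : PSpace.{u}) : PSpace.{u} := collapse (kprod3 A B C) (fatWedge A B C)

namespace smash3

variable (A B C : PSpace.{u})

/-- The projection `A × B × C → A ∧ B ∧ C`. -/
def proj : PMap (kprod3 A B C) (smash3 A B C) := collapse.mk _ _

variable {A B C} in
/-- A map of triple products that preserves the fat wedges induces a map of smash products. -/
def map {D E F : PSpace.{u}} (t : PMap (kprod3 A B C) (kprod3 D E F))
    (ht : ∀ x ∈ fatWedge A B C, t.toMap x ∈ fatWedge D E F) :
    PMap (smash3 A B C) (smash3 D E F) :=
  collapse.lift ((proj D E F).comp t) fun x hx =>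
    Quot.sound ⟨ht x hx, Or.inl rfl⟩

/-- The twisting function `t₂₁₃ : A ∧ B ∧ C → B ∧ A ∧ C`. -/
def t213 : PMap (smash3 A B C) (smash3 B A C) :=
  map (kprod3.t213 A B C) (by
    rintro x (h | h | h)
    · exact Or.inr (Or.inl h)
    · exact Or.inl h
    · exact Or.inr (Or.inr h))

/-- The twisting function `t₃₂₁ : A ∧ B ∧ C → C ∧ B ∧ A`. -/
def t321 : PMap (smash3 A B C) (smash3 C B A) :=
  map (kprod3.t321 A B C) (by
    rintro x (h | h | h)
    · exact Or.inr (Or.inr h)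
    · exact Or.inr (Or.inl h)
    · exact Or.inl h)

/-- The twisting function `t₁₃₂ : A ∧ B ∧ C → A ∧ C ∧ B`. -/
def t132 : PMap (smash3 A B C) (smash3 A C B) :=
  map (kprod3.t132 A B C) (by
    rintro x (h | h | h)
    · exact Or.inl h
    · exact Or.inr (Or.inr h)
    · exact Or.inr (Or.inl h))

/-- The twisting function `t₃₁₂ : A ∧ B ∧ C → C ∧ A ∧ B`. -/
def t312 : PMap (smash3 A B C) (smash3 C A B) :=
  map (kprod3.t312 A B C) (by
    rintro x (h | h | h)
    · exact Or.inr (Or.inl h)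
    · exact Or.inr (Or.inr h)
    · exact Or.inl h)

/-- The twisting function `t₂₃₁ : A ∧ B ∧ C → B ∧ C ∧ A`. -/
def t231 : PMap (smash3 A B C) (smash3 B C A) :=
  map (kprod3.t231 A B C) (by
    rintro x (h | h | h)
    · exact Or.inr (Or.inr h)
    · exact Or.inl h
    · exact Or.inr (Or.inl h))

/-- The natural map `A ∧ B ∧ C → (A ∧ B) ∧ C`. -/
def toSmash : PMap (smash3 A B C) (smash (smash A B) C) :=
  collapse.lift
    ((smash.proj (smash A B) C).comp
      (kprod.pair ((smash.proj A B).comp (kprod.fst (kprod A B) C)) (kprod.snd (kprod A B) C)))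
    (by
      have key : ∀ x : kprod3 A B C, (Prod.fst (Prod.fst x) = A.pt ∨ Prod.snd (Prod.fst x) = B.pt) →
          (smash.proj A B).toMap (Prod.fst x) = (smash A B).pt := fun x h =>
        Quot.sound ⟨h, Or.inl rfl⟩
      rintro x (h | h | h)
      · exact Quot.sound ⟨Or.inl (key x (Or.inl h)), Or.inl rfl⟩
      · exact Quot.sound ⟨Or.inl (key x (Or.inr h)), Or.inl rfl⟩
      · exact Quot.sound ⟨Or.inr h, Or.inl rfl⟩)

end smash3

/-! Fox groups -/

/-- `W ⊔ *`, the space `W` with a disjoint base point. -/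
def addPt (W : PSpace.{u}) : PSpace.{u} where
  carrier := W.carrier ⊕ PUnit.{u + 1}
  top := inferInstance
  pt := Sum.inr PUnit.unit

/-- The pointed map `W ⊔ * → V` that is `f` on `W`; `f` need not preserve base points. -/
def addPt.desc {W V : PSpace.{u}} (f : C(W, V)) : PMap (addPt W) V :=
  ⟨⟨(Sum.elim f fun _ => V.pt : W.carrier ⊕ PUnit.{u + 1} → V),
    f.continuous.sumElim continuous_const⟩, rfl⟩

/-- The map `f ⊔ * : W ⊔ * → V ⊔ *`. -/
def addPt.map {W V : PSpace.{u}} (f : C(W, V)) : PMap (addPt W) (addPt V) :=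
  addPt.desc (V := addPt V)
    ⟨(fun w => Sum.inl (f w) : W → V.carrier ⊕ PUnit.{u + 1}), continuous_inl.comp f.continuous⟩

/-- The Fox group `τ_W(X) = [Σ(W ⊔ *), X]`. -/
abbrev Fox (W : PSpace.{u}) (X : PSpace.{v}) : Type (max u v) := HClass (Susp (addPt W)) X

/-- The function `[ΣV, X] → τ_W(X)` induced by `W ⊔ * → V`, for a map `f : W → V`. -/
def Fox.image {W V : PSpace.{u}} {X : PSpace.{v}} (f : C(W, V)) (ξ : HClass (Susp V) X) :
    Fox W X :=
  HClass.pull (Susp.map (addPt.desc f)) ξ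

/-- The function `τ_V(X) → τ_W(X)` induced by a map `f : W → V`. -/
def Fox.pull {W V : PSpace.{u}} {X : PSpace.{v}} (f : C(W, V)) (ξ : Fox V X) : Fox W X :=
  HClass.pull (Susp.map (addPt.map f)) ξ

/-! Generalized Whitehead products -/

/-- `κ ∈ [Σ(A ∧ B), X]` is a generalized Whitehead product of `ξ` and `η`: a representative of `κ`,
composed with `Σ(A × B) → Σ(A ∧ B)`, is homotopic to `f' · g' · f'⁻¹ · g'⁻¹`, where `f` and `g`
represent `ξ` and `η`, `f' = f ∘ Σp_A` and `g' = g ∘ Σp_B`. -/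
def IsGWP {A B : PSpace.{u}} {X : PSpace.{v}} (ξ : HClass (Susp A) X) (η : HClass (Susp B) X)
    (κ : HClass (Susp (smash A B)) X) : Prop :=
  κ.pull (Susp.map (smash.proj A B)) =
    comm (ξ.pull (Susp.map (kprod.fst A B))) (η.pull (Susp.map (kprod.snd A B)))

/-- The generalized Whitehead product `[ξ, η] ∈ [Σ(A ∧ B), X]`. -/
def gwp {A B : PSpace.{u}} {X : PSpace.{v}} (ξ : HClass (Susp A) X) (η : HClass (Susp B) X) :
    HClass (Susp (smash A B)) X :=
  @Classical.epsilon _ ⟨1⟩ (IsGWP ξ η)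

/-- The iterated product `[[ξ, η], ζ]`, as an element of `[Σ(A ∧ B ∧ C), X]`. -/
def gwp3 {A B C : PSpace.{u}} {X : PSpace.{v}} (ξ : HClass (Susp A) X) (η : HClass (Susp B) X)
    (ζ : HClass (Susp C) X) : HClass (Susp (smash3 A B C)) X :=
  (gwp (gwp ξ η) ζ).pull (Susp.map (smash3.toSmash A B C))

/-! The sphere `S⁰`, and the action of the fundamental group -/

/-- The sphere `S⁰`: two points, discrete, with base point `false`. -/
def S0 : PSpace.{u} where
  carrier := ULift.{u} Bool
  top := ⊥
  pt := ⟨false⟩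

/-- The image in `τ_W(X)` of an element of `π₁(X) = [S¹, X] = [ΣS⁰, X]`, by way of the map
`W ⊔ * → S⁰` that takes `W` to the point other than the base point. -/
def piOneImage (W : PSpace.{u}) {X : PSpace.{v}} (ω : HClass (Susp S0.{u}) X) : Fox W X :=
  Fox.image (ContinuousMap.const W (ULift.up true : S0.{u})) ω

/-- `θ` is the result of the classical action of `ω ∈ π₁(X)` on `η ∈ [ΣW, X]`, which is the action
in the decomposition of `τ_W(X)` as the semidirect product of `[ΣW, X]` and `π₁(X)`. -/
def IsAction {W : PSpace.{u}} {X : PSpace.{v}} (ω : HClass (Susp S0.{u}) X)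
    (η θ : HClass (Susp W) X) : Prop :=
  Fox.image (ContinuousMap.id W) θ = conj (Fox.image (ContinuousMap.id W) η) (piOneImage W ω)

/-- The classical action `η^ω` of `ω ∈ π₁(X)` on `η ∈ [ΣW, X]`. -/
def action {W : PSpace.{u}} {X : PSpace.{v}} (ω : HClass (Susp S0.{u}) X)
    (η : HClass (Susp W) X) : HClass (Susp W) X :=
  @Classical.epsilon _ ⟨1⟩ (IsAction ω η)

open Classical in
/-- `ξ · η` for `ξ ∈ [ΣA, X]`: this is `η^ξ` if `A` is `S⁰` (up to pointed homotopy equivalence),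
so that `ξ` is an element of `π₁(X)`, and `η` otherwise. -/
def dot {A W : PSpace.{u}} {X : PSpace.{v}} (ξ : HClass (Susp A) X) (η : HClass (Susp W) X) :
    HClass (Susp W) X :=
  if h : ∃ s : PMap S0.{u} A, IsHEquiv s then action (ξ.pull (Susp.map h.choose)) η else η

/-! The spaces considered -/

/-- `A` is well-pointed: its base point is an NDR (for Hausdorff spaces: the inclusion of the
base point is a closed cofibration). -/
def WellPointed (A : PSpace.{u}) : Prop :=
  ∃ (r : C(A, I)) (h : C(A × I, A)),
    (∀ a, r a = 0 ↔ a = A.pt) ∧ (∀ a, h (a, 0) = a) ∧ (∀ t, h (A.pt, t) = A.pt) ∧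
      ∀ a, r a < 1 → h (a, 1) = A.pt

/-- `A` has the pointed homotopy type of a well-pointed compactly generated Hausdorff space. -/
def HasCGHType (A : PSpace.{u}) : Prop :=
  ∃ A' : PSpace.{u}, T2Space A' ∧ CompactlyGeneratedSpace A' ∧ WellPointed A' ∧
    ∃ f : PMap A A', IsHEquiv f

end Jacobi

end

noncomputable section

namespace Jacobi

open Topology unitInterval
open scoped commutatorElement

/-! The group of free homotopy classes of maps to a loop space -/

/-! All three identities are the Hall–Witt identity `hall_witt`, read in one group. By adjunction a
class in `[ΣV, X]` gives a free homotopy class of maps `V → ΩX`. These classes form a group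
`LoopClass V X`, functorial for all maps in `V`, based or not. In `LoopClass (kprod3 A B C) X` the
pulled back classes `a`, `b`, `c` of `α`, `β`, `γ` live together, and a twisted iterated Whitehead
product becomes an iterated commutator of them (`smash3.pull_toLoops_gwp3`).

To return to the smash product, `[Σ(A ∧ B ∧ C), X]` must inject into this group. Instead of an exact
sequence of cofibrations, the faces of the product are treated one at a time: near a face a
deformation is available (`Face`), and since the target is a loop space, a homotopy can be
multiplied by the inverse of its retraction to the face, which makes it trivial there. This gives
`Separated.union`, hence injectivity, and also the description of the image needed for existence of
the products. All this uses only a homotopy invariant form of well-pointedness, `HWellPointed`.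

For (2), suppose that `ΣA` is co-commutative. Two classes on `A × D × E` that vanish where the first
coordinate is the base point commute: each slice over `(d, e)` is a map `ΣA → X`, and the homotopy
`T ∘ ν ≃ ν` applies to all slices at once (`kprod3.commute_of_coCommutative`). Conjugations and
inverses then drop out of Hall–Witt.

For (3), if `A ≃ S⁰`, the product splits into two open and closed pieces: on one the smash class is
trivial, on the other `a` is the constant class given by the loop. So conjugation by `a` is the
action of `π₁(X)` (`kprod3.conj_eq_of_isHEquiv`). In the co-commutative case conjugation by `a` does
nothing, and `smash3.toLoops_dot` covers both. -/

/-- The loop space of a pointed space. -/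
abbrev Loops (X : PSpace.{v}) : Type v := Path X.pt X.pt

namespace Loops

variable {X : PSpace.{v}}

/-- Concatenation of loops. -/
def mul : C(Loops X × Loops X, Loops X) := ⟨fun p => p.1.trans p.2, Path.continuous_trans⟩

/-- Reversal of loops. -/
def inv : C(Loops X, Loops X) := ⟨fun p => p.symm, Path.continuous_symm⟩

/-- The contraction of `p · p⁻¹`, as a homotopy starting at the constant loop. -/
def cancel : C(I × Loops X, Loops X) :=
  ⟨fun z => (Path.Homotopy.reflTransSymm z.2).eval z.1, by
    refine Path.continuous_uncurry_iff.1 ?_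
    have h : Continuous fun z : (I × Loops X) × I =>
      z.1.2 ⟨Path.Homotopy.reflTransSymmAux (z.1.1, z.2),
        Path.Homotopy.reflTransSymmAux_mem_I _⟩ := by fun_prop
    exact h⟩

theorem cancel_zero (p : Loops X) : cancel (0, p) = Path.refl _ :=
  (Path.Homotopy.reflTransSymm p).eval_zero

theorem cancel_one (p : Loops X) : cancel (1, p) = p.trans p.symm :=
  (Path.Homotopy.reflTransSymm p).eval_one

theorem cancel_refl (t : I) : cancel (t, Path.refl X.pt) = Path.refl _ := rfl

/-- The associativity homotopy. -/
def assoc : C(I × (Loops X × Loops X × Loops X), Loops X) :=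
  ⟨fun z => (Path.Homotopy.transAssoc z.2.1 z.2.2.1 z.2.2.2).eval z.1, by
    refine Path.continuous_uncurry_iff.1 ?_
    have hc : Continuous fun z : (I × (Loops X × Loops X × Loops X)) × I =>
        z.1.2.1.trans (z.1.2.2.1.trans z.1.2.2.2) := by
      refine Continuous.path_trans (by fun_prop) (Continuous.path_trans ?_ ?_) <;> fun_prop
    -- `transAssoc` moves only the parameter of the loop `p · (q · r)`, along the segment from its
    -- reparametrisation to `t`. It is a reversed homotopy, whence `σ (σ _)`.
    have h : Continuous fun z : (I × (Loops X × Loops X × Loops X)) × I =>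
      (z.1.2.1.trans (z.1.2.2.1.trans z.1.2.2.2)) ⟨σ (σ z.1.1) * z.2 + σ z.1.1 *
        (⟨Path.Homotopy.transAssocReparamAux z.2,
          Path.Homotopy.transAssocReparamAux_mem_I z.2⟩ : I),
        show (σ (σ z.1.1) : ℝ) • (z.2 : ℝ) + (σ z.1.1 : ℝ) • _ ∈ I from
      convex_Icc _ _ z.2.2 (⟨Path.Homotopy.transAssocReparamAux z.2,
          Path.Homotopy.transAssocReparamAux_mem_I z.2⟩ : I).2
          (by unit_interval) (by unit_interval) (by simp)⟩ := by
      refine hc.eval ?_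
      fun_prop
    exact h⟩

theorem assoc_zero (p : Loops X × Loops X × Loops X) :
    assoc (0, p) = (p.1.trans p.2.1).trans p.2.2 :=
  (Path.Homotopy.transAssoc p.1 p.2.1 p.2.2).eval_zero

theorem assoc_one (p : Loops X × Loops X × Loops X) :
    assoc (1, p) = p.1.trans (p.2.1.trans p.2.2) :=
  (Path.Homotopy.transAssoc p.1 p.2.1 p.2.2).eval_one

end Loops

/-- The set of free homotopy classes of maps from `W` to the loop space of `X`. -/
def LoopClass (W : Type u) [TopologicalSpace W] (X : PSpace.{v}) : Type (max u v) :=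
  Quotient (⟨ContinuousMap.Homotopic, ContinuousMap.Homotopic.equivalence⟩ : Setoid C(W, Loops X))

namespace LoopClass

variable {W : Type u} [TopologicalSpace W] {V : Type w} [TopologicalSpace V] {X : PSpace.{v}}

/-- The class of a map. -/
def mk (f : C(W, Loops X)) : LoopClass W X := Quotient.mk _ f

theorem mk_eq_iff {f g : C(W, Loops X)} : mk f = mk g ↔ f.Homotopic g := Quotient.eq

theorem ind {p : LoopClass W X → Prop} (h : ∀ f, p (mk f)) (x : LoopClass W X) : p x :=
  Quotient.ind h x

/-- The constant map at the constant loop. -/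
def cst (W : Type u) [TopologicalSpace W] (X : PSpace.{v}) : C(W, Loops X) :=
  ContinuousMap.const W (Path.refl X.pt)

/-- The pointwise product of maps to the loop space. -/
def mulMap (f g : C(W, Loops X)) : C(W, Loops X) := Loops.mul.comp (f.prodMk g)

/-- The pointwise inverse of a map to the loop space. -/
def invMap (f : C(W, Loops X)) : C(W, Loops X) := Loops.inv.comp f

theorem mulMap_congr {f f' g g' : C(W, Loops X)} (hf : f.Homotopic f') (hg : g.Homotopic g') :
    (mulMap f g).Homotopic (mulMap f' g') := by
  obtain ⟨F⟩ := hf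
  obtain ⟨G⟩ := hg
  refine ⟨⟨Loops.mul.comp (F.toContinuousMap.prodMk G.toContinuousMap), ?_, ?_⟩⟩
  · intro x; exact congrArg₂ (fun p q => Loops.mul (p, q)) (F.apply_zero x) (G.apply_zero x)
  · intro x; exact congrArg₂ (fun p q => Loops.mul (p, q)) (F.apply_one x) (G.apply_one x)

theorem mulMap_assoc (f g h : C(W, Loops X)) :
    (mulMap (mulMap f g) h).Homotopic (mulMap f (mulMap g h)) :=
  ⟨⟨Loops.assoc.comp ((ContinuousMap.id I).prodMap (f.prodMk (g.prodMk h))),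
    fun x => Loops.assoc_zero (f x, g x, h x), fun x => Loops.assoc_one (f x, g x, h x)⟩⟩

/-- The unit homotopy of the H-space `ΩX` is stationary at the unit; this relative form is what
`Face.homotopicRel` needs. -/
theorem mulMap_cst (f : C(W, Loops X)) :
    (mulMap f (cst W X)).HomotopicRel f {w | f w = Path.refl _} := by
  let H := HSpace.hmulE (X := Loops X)
  refine ⟨⟨⟨H.toContinuousMap.comp ((ContinuousMap.id I).prodMap f),
    fun x => H.apply_zero (f x), fun x => H.apply_one (f x)⟩, fun t x hx => ?_⟩⟩
  exact H.eq_fst t (x := f x) hx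

theorem cst_mulMap (f : C(W, Loops X)) : (mulMap (cst W X) f).Homotopic f := by
  let H := HSpace.eHmul (X := Loops X)
  exact ⟨⟨H.toContinuousMap.comp ((ContinuousMap.id I).prodMap f),
    fun x => H.apply_zero (f x), fun x => H.apply_one (f x)⟩⟩

theorem mulMap_invMap (f : C(W, Loops X)) : (mulMap f (invMap f)).Homotopic (cst W X) :=
  ContinuousMap.Homotopic.symm ⟨⟨Loops.cancel.comp ((ContinuousMap.id I).prodMap f),
    fun x => Loops.cancel_zero (f x), fun x => Loops.cancel_one (f x)⟩⟩

theorem invMap_invMap (f : C(W, Loops X)) : invMap (invMap f) = f := by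
  ext1 w
  exact Path.symm_symm _

instance : Group (LoopClass W X) where
  mul := Quotient.map₂ mulMap fun _ _ hf _ _ hg => mulMap_congr hf hg
  one := mk (cst W X)
  inv := Quotient.map invMap fun _ _ h =>
    ContinuousMap.Homotopic.comp (.refl Loops.inv) h
  mul_assoc := by
    rintro ⟨f⟩ ⟨g⟩ ⟨h⟩
    exact Quotient.sound (mulMap_assoc f g h)
  one_mul := by
    rintro ⟨f⟩
    exact Quotient.sound (cst_mulMap f)
  mul_one := by
    rintro ⟨f⟩
    exact Quotient.sound (mulMap_cst f).homotopic
  inv_mul_cancel := by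
    rintro ⟨f⟩
    have h := mulMap_invMap (invMap f)
    rw [invMap_invMap] at h
    exact Quotient.sound h

/-- The homomorphism induced by a map of the sources. -/
def pull (q : C(W, V)) : LoopClass V X →* LoopClass W X where
  toFun := Quotient.map (fun f => f.comp q) fun _ _ h =>
    ContinuousMap.Homotopic.comp h (.refl q)
  map_one' := rfl
  map_mul' := by
    rintro ⟨f⟩ ⟨g⟩
    rfl

theorem pull_mk (q : C(W, V)) (f : C(V, Loops X)) : pull q (mk f) = mk (f.comp q) := rfl

theorem pull_congr {q q' : C(W, V)} (h : q.Homotopic q') (x : LoopClass V X) :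
    pull q x = pull q' x := by
  induction x using ind with
  | h f => exact mk_eq_iff.2 (.comp (.refl f) h)

theorem pull_pull {U : Type*} [TopologicalSpace U] (q : C(W, V)) (p : C(U, W))
    (x : LoopClass V X) : pull p (pull q x) = pull (q.comp p) x := by
  induction x using ind with
  | h f => rfl

theorem pull_id (x : LoopClass W X) : pull (ContinuousMap.id W) x = x := by
  induction x using ind with
  | h f => rfl

theorem mk_eq_one_iff {f : C(W, Loops X)} : mk f = 1 ↔ f.Homotopic (cst W X) := mk_eq_iff

end LoopClass

/-! Deformation data for the faces of a product -/

/-- `F` is a retract of `W` with a neighbourhood that deforms into `F`, compatibly with the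
subset `S`. -/
structure Face {W : Type u} [TopologicalSpace W] (S F : Set W) where
  /-- the retraction -/
  r : C(W, W)
  /-- a function that vanishes on `F` -/
  u : C(W, I)
  /-- a deformation of `W` that moves the points with `u < 1` into `F` -/
  h : C(I × W, W)
  r_mem : ∀ w, r w ∈ F
  r_eq : ∀ w ∈ F, r w = w
  r_S : ∀ w ∈ S, r w ∈ S
  u_eq : ∀ w ∈ F, u w = 0
  h_zero : ∀ w, h (0, w) = w
  h_one : ∀ w, u w < 1 → h (1, w) ∈ F
  h_F : ∀ t, ∀ w ∈ F, h (t, w) ∈ F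
  h_S : ∀ t, ∀ w ∈ S, h (t, w) ∈ S

namespace Face

variable {W : Type u} [TopologicalSpace W] {S F : Set W} {X : PSpace.{v}}

/-- A function of the parameter `u` that falls from `1` to `0` on `[0, 1/2]`. -/
def drop (t : I) : I := Set.projIcc 0 1 zero_le_one (1 - 2 * (t : ℝ))

theorem continuous_drop : Continuous drop := by unfold drop; fun_prop

theorem drop_zero : drop 0 = 1 := Set.projIcc_of_right_le _ (by simp)

theorem drop_of_le {t : I} (h : (1 / 2 : ℝ) ≤ t) : drop t = 0 :=
  Set.projIcc_of_le_left _ (by linarith)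

/-- The end of the deformation. -/
def e (D : Face S F) : C(W, W) := ⟨fun w => D.h (1, w), by fun_prop⟩

theorem homotopic_comp_e (D : Face S F) {Y : Type*} [TopologicalSpace Y] {T : Set W}
    (hT : ∀ t, ∀ w ∈ T, D.h (t, w) ∈ T) {f : C(W, Y)} {y : Y} (hf : ∀ w ∈ T, f w = y) :
    f.HomotopicRel (f.comp D.e) T := by
  refine ⟨⟨⟨f.comp D.h, fun w => congrArg f (D.h_zero w), fun w => rfl⟩, fun t w hw => ?_⟩⟩
  exact (hf _ (hT t w hw)).trans (hf w hw).symm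

theorem lt_of_le_half {t : I} (h : (t : ℝ) ≤ 1 / 2) : t < 1 := by
  rw [← Subtype.coe_lt_coe]
  exact h.trans_lt (by norm_num)

/-- A homotopy on `F`, starting at the restriction of `g`, extends to `W` after a deformation. -/
theorem exists_homotopic (D : Face S F) {g : C(W, Loops X)} (hg : ∀ w ∈ S, g w = Path.refl _)
    (hr : (g.comp D.r).HomotopicRel (LoopClass.cst W X) S) :
    ∃ f : C(W, Loops X), (∀ w ∈ S ∪ F, f w = Path.refl _) ∧ g.Homotopic f := by
  obtain ⟨N⟩ := hr
  -- Where `u ≤ 1/2` the deformed point lies in `F`, where `N` starts at `g`. The homotopy runs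
  -- fully on `F` and for a time falling to `0` at `u = 1/2`, so that it glues with the stationary
  -- `g` beyond.
  let K : I × W → Loops X := fun z =>
    if (D.u z.2 : ℝ) ≤ 1 / 2 then N (z.1 * drop (D.u z.2), D.h (1, z.2)) else g (D.h (1, z.2))
  have hK : Continuous K := by
    have := continuous_drop
    refine Continuous.if_le (by fun_prop) (by fun_prop) (by fun_prop) continuous_const ?_
    rintro ⟨t, w⟩ h
    have h' : (D.u w : ℝ) = 1 / 2 := h
    have hF := D.h_one w (lt_of_le_half h'.le)
    show N (t * drop (D.u w), D.h (1, w)) = g (D.h (1, w))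
    rw [drop_of_le h'.ge, mul_zero, N.apply_zero, ContinuousMap.comp_apply, D.r_eq _ hF]
  refine ⟨⟨fun w => K (1, w), by fun_prop⟩, ?_, ?_⟩
  · rintro w (hw | hw)
    · have hS := D.h_S 1 w hw
      show (if _ then _ else _) = _
      split_ifs
      · exact (N.eq_snd _ hS)
      · exact hg _ hS
    · show (if _ then N (1 * drop (D.u w), _) else _) = _
      rw [D.u_eq w hw, drop_zero, if_pos (by simp), one_mul, N.apply_one]
      rfl
  · refine (D.homotopic_comp_e (T := ∅) (by simp) (y := Path.refl _) (by simp)).homotopic.trans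
      ⟨⟨⟨K, hK⟩, fun w => ?_, fun w => rfl⟩⟩
    show (if _ then N (0 * drop (D.u w), _) else _) = g (D.h (1, w))
    split_ifs with h
    · rw [zero_mul, N.apply_zero, ContinuousMap.comp_apply, D.r_eq _ (D.h_one w (lt_of_le_half h))]
    · rfl

/-- A homotopy relative to `S` of maps that are trivial on `F` can be made relative to `F`. -/
theorem homotopicRel (D : Face S F) {f g : C(W, Loops X)} (hf : ∀ w ∈ S ∪ F, f w = Path.refl _)
    (hg : ∀ w ∈ S ∪ F, g w = Path.refl _) (hfg : f.HomotopicRel g S) :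
    f.HomotopicRel g (S ∪ F) := by
  obtain ⟨H⟩ := hfg
  have hT : ∀ t, ∀ w ∈ S ∪ F, D.h (t, w) ∈ S ∪ F := fun t w hw =>
    hw.imp (D.h_S t w) (D.h_F t w)
  -- Away from `F` the homotopy is divided by its retraction to `F`. Near `F` this quotient has the
  -- form `p · p⁻¹`, and `cancel` contracts it to the constant loop as `u` falls from `1/2` to `0`.
  let K : I × W → Loops X := fun z =>
    if (D.u z.2 : ℝ) ≤ 1 / 2 then Loops.cancel (σ (drop (D.u z.2)), H (z.1, D.h (1, z.2)))
    else (H (z.1, D.h (1, z.2))).trans (H (z.1, D.r (D.h (1, z.2)))).symm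
  have hK : Continuous K := by
    have := continuous_drop
    refine Continuous.if_le (by fun_prop) ?_ (by fun_prop) continuous_const ?_
    · exact Continuous.path_trans (by fun_prop) (Path.continuous_symm.comp (by fun_prop))
    rintro ⟨t, w⟩ h
    have h' : (D.u w : ℝ) = 1 / 2 := h
    have hF := D.h_one w (lt_of_le_half h'.le)
    show Loops.cancel (σ (drop (D.u w)), H (t, D.h (1, w))) =
      (H (t, D.h (1, w))).trans (H (t, D.r (D.h (1, w)))).symm
    rw [drop_of_le h'.ge, unitInterval.symm_zero, Loops.cancel_one, D.r_eq _ hF]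
  -- At both ends the divisor is constant, since the end maps are trivial on `F`. What remains is
  -- the deformed end map times the constant loop, and `hc` joins this to the end map itself.
  have hend : ∀ (t : I) (k : C(W, Loops X)) (_ : ∀ w ∈ S ∪ F, k w = Path.refl _)
      (_ : ∀ w, H (t, w) = k w) (w : W), K (t, w) =
        LoopClass.mulMap (k.comp D.e) (LoopClass.cst W X) w := by
    intro t k hk hHk w
    show (if _ then _ else _) = (k (D.h (1, w))).trans (Path.refl _)
    split_ifs with h
    · have hF := D.h_one w (lt_of_le_half h)
      simp only [hHk]
      rw [hk _ (Or.inr hF), Loops.cancel_refl, Path.refl_trans_refl]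
    · simp only [hHk]
      rw [hk _ (Or.inr (D.r_mem _)), Path.refl_symm]
  have hc : ∀ k : C(W, Loops X), (∀ w ∈ S ∪ F, k w = Path.refl _) →
      k.HomotopicRel (LoopClass.mulMap (k.comp D.e) (LoopClass.cst W X)) (S ∪ F) := by
    intro k hk
    refine (D.homotopic_comp_e hT hk).trans ?_
    obtain ⟨M⟩ := (LoopClass.mulMap_cst (k.comp D.e)).symm
    exact ⟨⟨M.toHomotopy, fun t w hw => M.eq_fst t (hk _ (hT 1 w hw))⟩⟩
  refine (hc f hf).trans (.trans ⟨⟨⟨⟨K, hK⟩, hend 0 f hf H.apply_zero, hend 1 g hg H.apply_one⟩,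
    fun t w hw => ?_⟩⟩ (hc g hg).symm)
  have h1 : LoopClass.mulMap (f.comp D.e) (LoopClass.cst W X) w = Path.refl _ := by
    show (f (D.h (1, w))).trans (Path.refl _) = _
    rw [hf _ (hT 1 w hw), Path.refl_trans_refl]
  refine Eq.trans ?_ h1.symm
  show (if _ then _ else _) = _
  rcases hw with hw | hw
  · have h2 : ∀ w ∈ S, H (t, w) = Path.refl _ := fun w hw =>
      (H.eq_fst t hw).trans (hf w (Or.inl hw))
    have hS := D.h_S 1 w hw
    simp only [h2 _ hS, h2 _ (D.r_S _ hS), Loops.cancel_refl, Path.refl_symm,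
      Path.refl_trans_refl, ite_self]
  · rw [D.u_eq w hw, drop_zero, if_pos (by simp), unitInterval.symm_one, Loops.cancel_zero]

end Face

/-- The maps that are trivial on `S` are determined up to homotopy relative to `S` by their free
homotopy class, and represent the classes that are killed by the maps in `R`. -/
structure Separated {W : Type u} [TopologicalSpace W] (X : PSpace.{v}) (S : Set W)
    (R : Set C(W, W)) : Prop where
  inj : ∀ f g : C(W, Loops X), (∀ w ∈ S, f w = Path.refl _) → (∀ w ∈ S, g w = Path.refl _) →
    f.Homotopic g → f.HomotopicRel g S
  surj : ∀ x : LoopClass W X, (∀ r ∈ R, LoopClass.pull r x = 1) →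
    ∃ f : C(W, Loops X), (∀ w ∈ S, f w = Path.refl _) ∧ LoopClass.mk f = x
  mem : ∀ r ∈ R, ∀ w, r w ∈ S

namespace Separated

variable {W : Type u} [TopologicalSpace W] {X : PSpace.{v}} {S F : Set W} {R : Set C(W, W)}

theorem empty : Separated X (∅ : Set W) ∅ where
  inj f g _ _ h := ContinuousMap.homotopicRel_empty.2 h
  surj x _ := by
    induction x using LoopClass.ind with
    | h f => exact ⟨f, by simp, rfl⟩
  mem := by simp

/-- Induction on faces. For surjectivity, `g ∘ r` is trivial on `S` and freely null-homotopic; by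
injectivity at the previous stage it is null-homotopic relative to `S`, and that null-homotopy is
what extends from `F`. -/
theorem union (h : Separated X S R) (D : Face S F) : Separated X (S ∪ F) (insert D.r R) where
  inj f g hf hg hfg := D.homotopicRel hf hg
    (h.inj f g (fun w hw => hf w (Or.inl hw)) (fun w hw => hg w (Or.inl hw)) hfg)
  surj x hx := by
    obtain ⟨g, hg, rfl⟩ := h.surj x fun r hr => hx r (Or.inr hr)
    have h1 : (g.comp D.r).HomotopicRel (LoopClass.cst W X) S :=
      h.inj _ _ (fun w hw => hg _ (D.r_S w hw)) (fun _ _ => rfl)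
        (LoopClass.mk_eq_one_iff.1 (hx D.r (Or.inl rfl)))
    obtain ⟨f, hf, hgf⟩ := D.exists_homotopic hg h1
    exact ⟨f, hf, LoopClass.mk_eq_iff.2 hgf.symm⟩
  mem := by
    rintro r (rfl | hr) w
    · exact Or.inr (D.r_mem w)
    · exact Or.inl (h.mem r hr w)

theorem of_face (D : Face (∅ : Set W) F) : Separated X F {D.r} := by
  have h := Separated.empty.union (X := X) D
  rwa [Set.empty_union, insert_empty_eq] at h

end Separated

/-! Maps from and to products with the compactly generated topology -/

namespace kprod

variable {A B A' B' : PSpace.{u}}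

theorem continuous_ofProd {S : Type u} [TopologicalSpace S] [CompactSpace S] [T2Space S]
    {a : S → A} {b : S → B} (ha : Continuous a) (hb : Continuous b) :
    Continuous fun s => ofProd A B (a s, b s) :=
  continuous_ofProd_comp (CompHaus.of S) ⟨fun s => (a s, b s), ha.prodMk hb⟩

/-- A function on the product of `A × B` and a locally compact space is continuous if it is
continuous on compact Hausdorff spaces over `A × B`. -/
theorem continuous_of_compact {L : Type*} [TopologicalSpace L] [LocallyCompactSpace L]
    {Z : Type*} [TopologicalSpace Z] {F : kprod A B × L → Z}
    (h : ∀ (S : Type u) [TopologicalSpace S] [CompactSpace S] [T2Space S] (a : S → A) (b : S → B),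
      Continuous a → Continuous b →
        Continuous fun z : S × L => F (ofProd A B (a z.1, b z.1), z.2)) :
    Continuous F := by
  have h1 : ∀ p : kprod A B, Continuous fun l => F (p, l) := fun p =>
    (h PUnit (fun _ => p.1) (fun _ => p.2) continuous_const continuous_const).comp
      (by fun_prop : Continuous fun l : L => (PUnit.unit, l))
  -- Compact test spaces detect continuity only on the k-product itself, so `L` is moved to the
  -- target by currying; local compactness of `L` allows the return.
  let G : kprod A B → C(L, Z) := fun p => ⟨fun l => F (p, l), h1 p⟩
  have hG : Continuous G := by
    refine continuous_from_compactlyGenerated (X := A.carrier × B.carrier) G fun S g => ?_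
    refine ContinuousMap.continuous_of_continuous_uncurry _ ?_
    exact h S (fun s => (g s).1) (fun s => (g s).2) (by fun_prop) (by fun_prop)
  exact ContinuousMap.continuous_uncurry_of_continuous ⟨G, hG⟩

/-- The product of two homotopies. -/
def mapHomotopy (h : C(I × A, A')) (k : C(I × B, B')) : C(I × kprod A B, kprod A' B') where
  toFun z := ofProd A' B' (h (z.1, (fst A B).toMap z.2), k (z.1, (snd A B).toMap z.2))
  continuous_toFun := by
    have : Continuous fun z : kprod A B × I =>
        ofProd A' B' (h (z.2, (fst A B).toMap z.1), k (z.2, (snd A B).toMap z.1)) :=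
      continuous_of_compact fun S _ _ _ a b ha hb =>
        continuous_ofProd (S := S × I) (a := fun z => h (z.2, a z.1))
          (b := fun z => k (z.2, b z.1)) (by fun_prop) (by fun_prop)
    exact this.comp continuous_swap

/-- The product of two maps, which need not preserve base points. -/
def map (f : C(A, A')) (g : C(B, B')) : C(kprod A B, kprod A' B') :=
  (mapHomotopy (f.comp ContinuousMap.snd) (g.comp ContinuousMap.snd)).comp
    ((ContinuousMap.const _ 0).prodMk (ContinuousMap.id _))

theorem map_homotopic {f f' : C(A, A')} {g g' : C(B, B')} (hf : f.Homotopic f')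
    (hg : g.Homotopic g') : (map f g).Homotopic (map f' g') := by
  obtain ⟨F⟩ := hf
  obtain ⟨G⟩ := hg
  exact ⟨⟨mapHomotopy F.toContinuousMap G.toContinuousMap,
    fun p => Prod.ext (F.apply_zero p.1) (G.apply_zero p.2),
    fun p => Prod.ext (F.apply_one p.1) (G.apply_one p.2)⟩⟩

end kprod

namespace kprod3

variable {A B C A' B' C' : PSpace.{u}}

theorem continuous_of_compact {L : Type*} [TopologicalSpace L] [LocallyCompactSpace L]
    {Z : Type*} [TopologicalSpace Z] {F : kprod3 A B C × L → Z}
    (h : ∀ (S : Type u) [TopologicalSpace S] [CompactSpace S] [T2Space S] (a : S → A) (b : S → B)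
      (c : S → C), Continuous a → Continuous b → Continuous c →
        Continuous fun z : S × L => F (((a z.1, b z.1), c z.1), z.2)) :
    Continuous F :=
  kprod.continuous_of_compact fun S _ _ _ p c hp hc =>
    h S (fun s => (p s).1) (fun s => (p s).2) c ((kprod.fst A B).toMap.continuous.comp hp)
      ((kprod.snd A B).toMap.continuous.comp hp) hc

/-- The product of three maps, which need not preserve base points. -/
def mapMap (f : C(A, A')) (g : C(B, B')) (h : C(C, C')) : C(kprod3 A B C, kprod3 A' B' C') :=
  kprod.map (kprod.map f g) h

theorem mapMap_homotopic {f f' : C(A, A')} {g g' : C(B, B')} {h h' : C(C, C')}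
    (hf : f.Homotopic f') (hg : g.Homotopic g') (hh : h.Homotopic h') :
    (mapMap f g h).Homotopic (mapMap f' g' h') :=
  kprod.map_homotopic (kprod.map_homotopic hf hg) hh

variable (A B C)

/-- The self-map that moves the first coordinate to the base point. -/
def r1 : C(kprod3 A B C, kprod3 A B C) :=
  mapMap (ContinuousMap.const A A.pt) (ContinuousMap.id B) (ContinuousMap.id C)

/-- The self-map that moves the second coordinate to the base point. -/
def r2 : C(kprod3 A B C, kprod3 A B C) :=
  mapMap (ContinuousMap.id A) (ContinuousMap.const B B.pt) (ContinuousMap.id C)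

/-- The self-map that moves the third coordinate to the base point. -/
def r3 : C(kprod3 A B C, kprod3 A B C) :=
  kprod.map (ContinuousMap.id (kprod A B)) (ContinuousMap.const C C.pt)

end kprod3

namespace Face

variable {A B : PSpace.{u}}

/-- The same data for equal sets. -/
def copy {W : Type u} [TopologicalSpace W] {S F S' F' : Set W} (D : Face S F) (hS : S = S')
    (hF : F = F') : Face S' F' where
  r := D.r
  u := D.u
  h := D.h
  r_mem := hF ▸ D.r_mem
  r_eq := hF ▸ D.r_eq
  r_S := hS ▸ D.r_S
  u_eq := hF ▸ D.u_eq
  h_zero := D.h_zero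
  h_one := hF ▸ D.h_one
  h_F := hF ▸ D.h_F
  h_S := hS ▸ D.h_S

/-- The product of a face with a second factor. -/
def prodLeft {S F : Set A} (D : Face S F) (T : Set B) :
    Face {p : kprod A B | p.1 ∈ S ∨ p.2 ∈ T} {p : kprod A B | p.1 ∈ F} where
  r := kprod.map D.r (ContinuousMap.id B)
  u := D.u.comp (kprod.fst A B).toMap
  h := kprod.mapHomotopy D.h ContinuousMap.snd
  r_mem p := D.r_mem p.1
  r_eq p hp := Prod.ext (D.r_eq p.1 hp) rfl
  r_S p hp := hp.imp_left (D.r_S p.1)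
  u_eq p hp := D.u_eq p.1 hp
  h_zero p := Prod.ext (D.h_zero p.1) rfl
  h_one p hp := D.h_one p.1 hp
  h_F t p hp := D.h_F t p.1 hp
  h_S t p hp := hp.imp_left (D.h_S t p.1)

/-- The product of a face with a first factor. -/
def prodRight {S F : Set B} (D : Face S F) (T : Set A) :
    Face {p : kprod A B | p.1 ∈ T ∨ p.2 ∈ S} {p : kprod A B | p.2 ∈ F} where
  r := kprod.map (ContinuousMap.id A) D.r
  u := D.u.comp (kprod.snd A B).toMap
  h := kprod.mapHomotopy ContinuousMap.snd D.h
  r_mem p := D.r_mem p.2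
  r_eq p hp := Prod.ext rfl (D.r_eq p.2 hp)
  r_S p hp := hp.imp_right (D.r_S p.2)
  u_eq p hp := D.u_eq p.2 hp
  h_zero p := Prod.ext rfl (D.h_zero p.2)
  h_one p hp := D.h_one p.2 hp
  h_F t p hp := D.h_F t p.2 hp
  h_S t p hp := hp.imp_right (D.h_S t p.2)

end Face

/-! Well-pointedness up to homotopy -/

/-- The base point has a neighbourhood (in the sense of a halo) that contracts to it inside `A`,
relative to the base point. This property is invariant under pointed homotopy equivalences. -/
def HWellPointed (A : PSpace.{u}) : Prop :=
  ∃ (r : C(A, I)) (e : C(A, A)), r A.pt = 0 ∧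
    (ContinuousMap.id A).HomotopicRel e {A.pt} ∧ ∀ a, r a < 1 → e a = A.pt

theorem WellPointed.hWellPointed {A : PSpace.{u}} (h : WellPointed A) : HWellPointed A := by
  obtain ⟨r, k, h0, hk0, hkpt, hk1⟩ := h
  refine ⟨r, ⟨fun a => k (a, 1), by fun_prop⟩, (h0 _).2 rfl,
    ⟨⟨⟨⟨fun z => k (z.2, z.1), by fun_prop⟩, hk0, fun _ => rfl⟩, ?_⟩⟩, hk1⟩
  rintro t a rfl
  exact hkpt t

/-- The halo pulls back along `f`, and `g ∘ e ∘ f` is homotopic to `g ∘ f`, hence to the identity.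
An NDR function vanishing only at the base point would not survive the pull-back. -/
theorem HWellPointed.of_isHEquiv {A B : PSpace.{u}} (hB : HWellPointed B) {f : PMap A B}
    (hf : IsHEquiv f) : HWellPointed A := by
  obtain ⟨r, e, h0, he, h1⟩ := hB
  obtain ⟨g, hgf, -⟩ := hf
  refine ⟨r.comp f.toMap, g.toMap.comp (e.comp f.toMap), ?_, hgf.symm.trans ?_, fun a ha => ?_⟩
  · simp [f.map_pt, h0]
  · obtain ⟨H⟩ := he
    refine ⟨⟨⟨⟨fun z => g.toMap (H (z.1, f.toMap z.2)), by fun_prop⟩, ?_, ?_⟩, ?_⟩⟩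
    · intro a; simp [PMap.comp]
    · intro a; simp
    · rintro t a rfl
      have := H.eq_fst t (x := B.pt) rfl
      simp [PMap.comp, f.map_pt, this]
  · show g.toMap (e (f.toMap a)) = _
    rw [h1 _ ha, g.map_pt]

theorem HasCGHType.hWellPointed {A : PSpace.{u}} (h : HasCGHType A) : HWellPointed A := by
  obtain ⟨A', -, -, hA', f, hf⟩ := h
  exact hA'.hWellPointed.of_isHEquiv hf

/-- The face given by the base point. -/
def HWellPointed.face {A : PSpace.{u}} (h : HWellPointed A) : Face (∅ : Set A) {A.pt} where
  r := ContinuousMap.const A A.pt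
  u := h.choose
  h := h.choose_spec.choose_spec.2.1.some.toContinuousMap
  r_mem _ := rfl
  r_eq _ h := h.symm
  r_S _ h := h
  u_eq := by
    rintro _ rfl
    exact h.choose_spec.choose_spec.1
  h_zero := h.choose_spec.choose_spec.2.1.some.apply_zero
  h_one a ha := (h.choose_spec.choose_spec.2.1.some.apply_one a).trans
    (h.choose_spec.choose_spec.2.2 a ha)
  h_F t a ha := (h.choose_spec.choose_spec.2.1.some.eq_fst t ha).trans ha
  h_S _ _ h := h

/-- A deformation that keeps `S` inside `S` descends to `W / S`, because the product of `I` with a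
quotient map is again a quotient map. -/
theorem Face.hWellPointed_collapse {W : PSpace.{u}} {S : Set W} (hpt : W.pt ∈ S) (r : C(W, I))
    (h : C(I × W, W)) (hr : ∀ w ∈ S, r w = 0) (h0 : ∀ w, h (0, w) = w)
    (hS : ∀ t, ∀ w ∈ S, h (t, w) ∈ S) (h1 : ∀ w, r w < 1 → h (1, w) ∈ S) :
    HWellPointed (collapse W S) := by
  have hq : IsQuotientMap (collapse.mk W S).toMap := isQuotientMap_quot_mk
  have hmk : ∀ w ∈ S, (collapse.mk W S).toMap w = (collapse W S).pt := fun w hw =>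
    Quot.sound ⟨hw, hpt⟩
  let K : I × collapse W S → collapse W S := fun z =>
    Quot.lift (fun w => (collapse.mk W S).toMap (h (z.1, w)))
      (fun x y hxy => (hmk _ (hS _ x hxy.1)).trans (hmk _ (hS _ y hxy.2)).symm) z.2
  have hK : Continuous K := by
    refine hq.continuous_lift_prod_right ?_
    exact (collapse.mk W S).toMap.continuous.comp h.continuous
  refine ⟨⟨Quot.lift r fun x y hxy => (hr x hxy.1).trans (hr y hxy.2).symm,
    continuous_quot_lift _ r.continuous⟩, ⟨fun a => K (1, a), by fun_prop⟩, hr _ hpt,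
    ⟨⟨⟨⟨K, hK⟩, ?_, fun _ => rfl⟩, ?_⟩⟩, ?_⟩
  · rintro ⟨w⟩
    exact congrArg (collapse.mk W S).toMap (h0 w)
  · rintro t _ rfl
    exact hmk _ (hS t _ hpt)
  · rintro ⟨w⟩ hw
    exact hmk _ (h1 w hw)

theorem HWellPointed.kprod {A B : PSpace.{u}} (hA : HWellPointed A) (hB : HWellPointed B) :
    HWellPointed (kprod A B) := by
  obtain ⟨r, e, h0, ⟨H⟩, h1⟩ := hA
  obtain ⟨r', e', h0', ⟨H'⟩, h1'⟩ := hB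
  refine ⟨(r.comp (kprod.fst A B).toMap) ⊔ (r'.comp (kprod.snd A B).toMap), kprod.map e e', ?_,
    ⟨⟨⟨kprod.mapHomotopy H.toContinuousMap H'.toContinuousMap,
      fun p => Prod.ext (H.apply_zero p.1) (H'.apply_zero p.2),
      fun p => Prod.ext (H.apply_one p.1) (H'.apply_one p.2)⟩, ?_⟩⟩, ?_⟩
  · show r A.pt ⊔ r' B.pt = 0
    rw [h0, h0', sup_idem]
  · rintro t _ rfl
    exact Prod.ext (H.eq_fst t (x := A.pt) rfl) (H'.eq_fst t (x := B.pt) rfl)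
  · intro p hp
    have hp' : r p.1 < 1 ∧ r' p.2 < 1 := max_lt_iff.1 hp
    exact Prod.ext (h1 _ hp'.1) (h1' _ hp'.2)

/-- The halo function is a minimum, not a maximum: the collapsed set is a union, so one coordinate
near its base point suffices. -/
theorem HWellPointed.smash {A B : PSpace.{u}} (hA : HWellPointed A) (hB : HWellPointed B) :
    HWellPointed (smash A B) := by
  refine Face.hWellPointed_collapse (Or.inl rfl)
    ((hA.face.u.comp (kprod.fst A B).toMap) ⊓ (hB.face.u.comp (kprod.snd A B).toMap))
    (kprod.mapHomotopy hA.face.h hB.face.h) (fun p hp => ?_)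
    (fun p => Prod.ext (hA.face.h_zero p.1) (hB.face.h_zero p.2)) (fun t p hp => ?_)
    (fun p hp => ?_)
  · show hA.face.u p.1 ⊓ hB.face.u p.2 = 0
    rcases hp with hp | hp
    · rw [hA.face.u_eq _ hp]; exact min_eq_left unitInterval.nonneg'
    · rw [hB.face.u_eq _ hp]; exact min_eq_right unitInterval.nonneg'
  · exact hp.imp (hA.face.h_F t p.1) (hB.face.h_F t p.2)
  · exact (min_lt_iff.1 hp).imp (hA.face.h_one p.1) (hB.face.h_one p.2)

theorem HWellPointed.smash3 {A B C : PSpace.{u}} (hA : HWellPointed A) (hB : HWellPointed B)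
    (hC : HWellPointed C) : HWellPointed (smash3 A B C) := by
  refine Face.hWellPointed_collapse (Or.inl rfl)
    ((hA.face.u.comp (kprod3.p1 A B C).toMap) ⊓ ((hB.face.u.comp (kprod3.p2 A B C).toMap) ⊓
      (hC.face.u.comp (kprod3.p3 A B C).toMap)))
    (kprod.mapHomotopy (kprod.mapHomotopy hA.face.h hB.face.h) hC.face.h) (fun p hp => ?_)
    (fun p => Prod.ext (Prod.ext (hA.face.h_zero p.1.1) (hB.face.h_zero p.1.2))
      (hC.face.h_zero p.2)) (fun t p hp => ?_) (fun p hp => ?_)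
  · show hA.face.u p.1.1 ⊓ (hB.face.u p.1.2 ⊓ hC.face.u p.2) = 0
    refine le_antisymm ?_ unitInterval.nonneg'
    rcases hp with hp | hp | hp
    · exact inf_le_left.trans (hA.face.u_eq _ hp).le
    · exact (inf_le_right.trans inf_le_left).trans (hB.face.u_eq _ hp).le
    · exact (inf_le_right.trans inf_le_right).trans (hC.face.u_eq _ hp).le
  · exact hp.imp (hA.face.h_F t p.1.1) (Or.imp (hB.face.h_F t p.1.2) (hC.face.h_F t p.2))
  · exact (min_lt_iff.1 hp).imp (hA.face.h_one p.1.1)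
      fun h => (min_lt_iff.1 h).imp (hB.face.h_one p.1.2) (hC.face.h_one p.2)

/-! Separation for base points, products of two spaces and products of three spaces -/

theorem HWellPointed.separated {A : PSpace.{u}} (hA : HWellPointed A) (X : PSpace.{v}) :
    Separated X {A.pt} {ContinuousMap.const A A.pt} :=
  .of_face hA.face

theorem kprod.separated {A B : PSpace.{u}} (hA : HWellPointed A) (hB : HWellPointed B)
    (X : PSpace.{v}) :
    Separated X {p : kprod A B | p.1 = A.pt ∨ p.2 = B.pt}
      {kprod.map (ContinuousMap.id A) (ContinuousMap.const B B.pt),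
        kprod.map (ContinuousMap.const A A.pt) (ContinuousMap.id B)} :=
  (Separated.of_face ((hA.face.prodLeft (B := B) ∅).copy (by ext; simp)
    (F' := {p : kprod A B | p.1 = A.pt}) rfl)).union
    ((hB.face.prodRight (A := A) {A.pt}).copy (by ext; simp) rfl)

theorem kprod3.separated_fst {A : PSpace.{u}} (hA : HWellPointed A) (B C : PSpace.{u})
    (X : PSpace.{v}) :
    Separated X {p : kprod3 A B C | p.1.1 = A.pt} {kprod3.r1 A B C} :=
  .of_face (((hA.face.prodLeft (B := B) ∅).prodLeft (B := C) ∅).copy (by ext; simp)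
    (F' := {p : kprod3 A B C | p.1.1 = A.pt}) rfl)

theorem kprod3.separated {A B C : PSpace.{u}} (hA : HWellPointed A) (hB : HWellPointed B)
    (hC : HWellPointed C) (X : PSpace.{v}) :
    Separated X (fatWedge A B C) {kprod3.r3 A B C, kprod3.r2 A B C, kprod3.r1 A B C} := by
  have h := ((kprod3.separated_fst hA B C X).union
    (((hB.face.prodRight (A := A) {A.pt}).prodLeft (B := C) ∅).copy (by ext; simp)
      (F' := {p : kprod3 A B C | p.1.2 = B.pt}) rfl)).union
    ((hC.face.prodRight (A := kprod A B) {p | p.1 = A.pt ∨ p.2 = B.pt}).copy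
      (by ext; simp) (F' := {p : kprod3 A B C | p.2 = C.pt}) rfl)
  have hS : fatWedge A B C = {p : kprod3 A B C | p.1.1 = A.pt} ∪
      {p : kprod3 A B C | p.1.2 = B.pt} ∪ {p : kprod3 A B C | p.2 = C.pt} := by
    ext p
    exact or_assoc.symm
  rw [hS]
  exact h

/-! The adjunction between suspensions and loop spaces -/

namespace Susp

variable {V : PSpace.{u}} {X : PSpace.{v}}

/-- The adjoint of a map of a suspension. -/
def adj (f : PMap (Susp V) X) : C(V, Loops X) where
  toFun v :=
    { toFun := fun t => f.toMap (mk v t)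
      continuous_toFun :=
        f.toMap.continuous.comp ((continuous_mk V).comp (Continuous.prodMk_right v))
      source' := (congrArg f.toMap (mk_eq_pt (Or.inr (Or.inl rfl)))).trans f.map_pt
      target' := (congrArg f.toMap (mk_eq_pt (Or.inr (Or.inr rfl)))).trans f.map_pt }
  continuous_toFun := Path.continuous_uncurry_iff.1 (f.toMap.continuous.comp (continuous_mk V))

theorem adj_pt (f : PMap (Susp V) X) : adj f V.pt = Path.refl _ := by
  ext t
  exact (congrArg f.toMap (mk_eq_pt (Or.inl rfl))).trans f.map_pt

theorem exists_adj (g : C(V, Loops X)) (hg : g V.pt = Path.refl _) :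
    ∃ f : PMap (Susp V) X, adj f = g := by
  have h0 : ∀ z ∈ suspEnds V, g z.1 z.2 = X.pt := by
    rintro ⟨a, t⟩ (h | h | h)
    · rw [show a = V.pt from h, hg]; rfl
    · rw [show t = 0 from h]; exact (g a).source
    · rw [show t = 1 from h]; exact (g a).target
  refine ⟨collapse.lift (A := cyl V) (S := suspEnds V) ⟨⟨fun z : V × I => g z.1 z.2, by fun_prop⟩,
    h0 (V.pt, 0) (Or.inl rfl)⟩ h0, ?_⟩
  ext a t
  rfl

/-- Homotopies correspond under the adjunction as maps do: one relative to the base point is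
constant on the collapsed ends of the cylinder and descends to `ΣV`. -/
theorem adj_homotopicRel_iff {f g : PMap (Susp V) X} :
    (adj f).HomotopicRel (adj g) {V.pt} ↔ f.Homotopic g := by
  constructor
  · rintro ⟨H⟩
    have h0 : ∀ s, ∀ z ∈ suspEnds V, H (s, z.1) z.2 = X.pt := by
      rintro s ⟨a, t⟩ (h | h | h)
      · have := (H.eq_fst s (x := a) h).trans (show adj f a = Path.refl _ by
          rw [show a = V.pt from h, adj_pt])
        exact congrArg (fun p : Loops X => p t) this
      · rw [show t = 0 from h]; exact (H (s, a)).source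
      · rw [show t = 1 from h]; exact (H (s, a)).target
    let K : I × Susp V → X := fun z =>
      Quot.lift (fun x : V × I => H (z.1, x.1) x.2)
        (fun x y h => (h0 _ x h.1).trans (h0 _ y h.2).symm) z.2
    have hq : IsQuotientMap (collapse.mk (cyl V) (suspEnds V)).toMap := isQuotientMap_quot_mk
    have hK : Continuous K := by
      refine hq.continuous_lift_prod_right ?_
      have : Continuous fun z : I × (V × I) => H (z.1, z.2.1) z.2.2 := by fun_prop
      exact this
    refine ⟨⟨⟨⟨K, hK⟩, ?_, ?_⟩, ?_⟩⟩
    · rintro ⟨⟨a, t⟩⟩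
      exact congrArg (fun p : Loops X => p t) (H.apply_zero a)
    · rintro ⟨⟨a, t⟩⟩
      exact congrArg (fun p : Loops X => p t) (H.apply_one a)
    · rintro s _ rfl
      exact (h0 s (V.pt, 0) (Or.inl rfl)).trans f.map_pt.symm
  · rintro ⟨H⟩
    let K : I × V → Loops X := fun z =>
      { toFun := fun t => H (z.1, mk z.2 t)
        continuous_toFun := H.continuous.comp
          (continuous_const.prodMk ((continuous_mk V).comp (Continuous.prodMk_right z.2)))
        source' := by
          rw [mk_eq_pt (Or.inr (Or.inl rfl))]
          exact (H.eq_fst z.1 (x := (Susp V).pt) rfl).trans f.map_pt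
        target' := by
          rw [mk_eq_pt (Or.inr (Or.inr rfl))]
          exact (H.eq_fst z.1 (x := (Susp V).pt) rfl).trans f.map_pt }
    have hK : Continuous K := by
      refine Path.continuous_uncurry_iff.1 ?_
      have h1 : Continuous fun z : (I × V) × I => mk z.1.2 z.2 :=
        (continuous_mk V).comp ((continuous_snd.comp continuous_fst).prodMk continuous_snd)
      exact H.continuous.comp ((continuous_fst.comp continuous_fst).prodMk h1)
    refine ⟨⟨⟨⟨K, hK⟩, ?_, ?_⟩, ?_⟩⟩
    · intro a
      ext t
      exact H.apply_zero _
    · intro a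
      ext t
      exact H.apply_one _
    · rintro s _ rfl
      ext t
      exact H.eq_fst s (mk_eq_pt (Or.inl rfl))

/-- Both sides use the same break at `1/2`, so the adjunction respects products strictly and not
only up to homotopy. -/
theorem adj_desc_comult (f g : PMap (Susp V) X) :
    adj ((wedge.desc f g).comp (comult V)) = LoopClass.mulMap (adj f) (adj g) := by
  ext a t
  show (wedge.desc f g).toMap (comultFun V (a, t)) = ((adj f a).trans (adj g a)) t
  rw [Path.trans_apply]
  unfold comultFun
  split_ifs with h
  · refine congrArg (fun s => f.toMap (mk a s)) (Set.projIcc_of_mem _ ⟨?_, ?_⟩)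
    · exact mul_nonneg zero_le_two t.2.1
    · linarith [show (t : ℝ) ≤ 1 / 2 from h]
  · refine congrArg (fun s => g.toMap (mk a s)) (Set.projIcc_of_mem _ ⟨?_, ?_⟩)
    · linarith [not_le.1 (show ¬ (t : ℝ) ≤ 1 / 2 from h)]
    · linarith [t.2.2]

end Susp

/-! From homotopy classes of maps of suspensions to classes of maps to loop spaces -/

namespace HClass

variable {V V' : PSpace.{u}} {X : PSpace.{v}}

/-- The free homotopy class of the adjoint map. -/
def toLoops : HClass (Susp V) X → LoopClass V X :=
  Quotient.lift (fun f => LoopClass.mk (Susp.adj f)) fun _ _ h =>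
    LoopClass.mk_eq_iff.2 (Susp.adj_homotopicRel_iff.2 h).homotopic

theorem toLoops_mul (x y : HClass (Susp V) X) : toLoops (x * y) = toLoops x * toLoops y := by
  induction x using Quotient.ind
  induction y using Quotient.ind
  exact congrArg LoopClass.mk (Susp.adj_desc_comult _ _)

theorem toLoops_inv (x : HClass (Susp V) X) : toLoops x⁻¹ = (toLoops x)⁻¹ := by
  induction x using Quotient.ind
  rfl

theorem toLoops_comm (x y : HClass (Susp V) X) :
    toLoops (comm x y) = ⁅toLoops x, toLoops y⁆ := by
  simp only [comm, toLoops_mul, toLoops_inv, commutatorElement_def]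

theorem toLoops_pull (f : PMap V V') (x : HClass (Susp V') X) :
    toLoops (x.pull (Susp.map f)) = LoopClass.pull f.toMap (toLoops x) := by
  induction x using Quotient.ind
  rfl

theorem pull_const_toLoops {W : Type*} [TopologicalSpace W] (x : HClass (Susp V) X) :
    LoopClass.pull (ContinuousMap.const W V.pt) (toLoops x) = 1 := by
  induction x using Quotient.ind with
  | _ f =>
    refine congrArg LoopClass.mk ?_
    ext1 w
    exact Susp.adj_pt f

end HClass

/-! Maps that collapse a subspace -/

/-- `V` is the quotient of `W` by the subset `S`, where `S` goes to the base point. -/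
structure IsCollapse {W : Type u} [TopologicalSpace W] {V : PSpace.{u}} (q : C(W, V))
    (S : Set W) : Prop where
  isQuotientMap : IsQuotientMap q
  map_mem : ∀ w ∈ S, q w = V.pt
  exists_mem : ∃ w ∈ S, q w = V.pt
  eq_or_mem : ∀ w w', q w = q w' → w = w' ∨ w ∈ S ∧ w' ∈ S

namespace IsCollapse

theorem id (V : PSpace.{u}) : IsCollapse (ContinuousMap.id V) {V.pt} where
  isQuotientMap := .id
  map_mem _ h := h
  exists_mem := ⟨V.pt, rfl, rfl⟩
  eq_or_mem _ _ h := Or.inl h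

theorem collapse {W : PSpace.{u}} {S : Set W} (h : W.pt ∈ S) :
    IsCollapse (collapse.mk W S).toMap S where
  isQuotientMap := isQuotientMap_quot_mk
  map_mem _ hw := Quot.sound ⟨hw, h⟩
  exists_mem := ⟨W.pt, h, rfl⟩
  eq_or_mem w w' hw := by
    -- The collapsing relation is not reflexive off `S`; the equivalence it generates is equality or
    -- joint membership in `S`.
    have h1 : Relation.EqvGen (fun x y : W => x ∈ S ∧ y ∈ S) w w' := Quot.eqvGen_exact hw
    clear hw
    induction h1 with
    | rel _ _ h => exact Or.inr h
    | refl => exact Or.inl rfl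
    | symm x y _ ih => exact ih.imp Eq.symm And.symm
    | trans x y z _ _ h1 h2 =>
      rcases h1 with rfl | h1
      · exact h2
      · rcases h2 with rfl | h2
        · exact Or.inr h1
        · exact Or.inr ⟨h1.1, h2.2⟩

variable {W : Type u} [TopologicalSpace W] {V : PSpace.{u}} {X : PSpace.{v}} {q : C(W, V)}
  {S : Set W} {R : Set C(W, W)}

theorem exists_comp_eq (h : IsCollapse q S) (f : C(W, Loops X)) (hf : ∀ w ∈ S, f w = Path.refl _) :
    ∃ g : C(V, Loops X), g V.pt = Path.refl _ ∧ g.comp q = f := by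
  have hfq : Function.FactorsThrough f q := fun w w' hw => by
    rcases h.eq_or_mem w w' hw with rfl | ⟨h1, h2⟩
    · rfl
    · rw [hf w h1, hf w' h2]
  have hc := h.isQuotientMap.lift_comp f hfq
  refine ⟨h.isQuotientMap.lift f hfq, ?_, hc⟩
  obtain ⟨w, hw, hwq⟩ := h.exists_mem
  rw [← hwq, ← hf w hw]
  exact congrArg (fun k : C(W, Loops X) => k w) hc

theorem homotopicRel (h : IsCollapse q S) {f g : C(V, Loops X)}
    (hfg : (f.comp q).HomotopicRel (g.comp q) S) : f.HomotopicRel g {V.pt} := by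
  obtain ⟨H⟩ := hfg
  -- The section is only set-theoretic: `H` is constant on the fibres of `q`, so the choice is
  -- immaterial and continuity comes from the quotient topology.
  let s := Function.surjInv h.isQuotientMap.surjective
  have hs : ∀ t w, H (t, s (q w)) = H (t, w) := fun t w => by
    have hw : q (s (q w)) = q w := Function.surjInv_eq _ _
    rcases h.eq_or_mem _ _ hw with h1 | ⟨h1, h2⟩
    · rw [h1]
    · rw [H.eq_fst t h1, H.eq_fst t h2]
      exact congrArg f hw
  refine ⟨⟨⟨⟨fun z => H (z.1, s z.2), ?_⟩, ?_, ?_⟩, ?_⟩⟩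
  · refine h.isQuotientMap.continuous_lift_prod_right ?_
    simp only [hs]
    exact H.continuous
  · intro v
    obtain ⟨w, rfl⟩ := h.isQuotientMap.surjective v
    exact (hs 0 w).trans (H.apply_zero w)
  · intro v
    obtain ⟨w, rfl⟩ := h.isQuotientMap.surjective v
    exact (hs 1 w).trans (H.apply_one w)
  · rintro t _ rfl
    obtain ⟨w, hw, hwq⟩ := h.exists_mem
    rw [← hwq]
    exact (hs t w).trans (H.eq_fst t hw)

/-- A free homotopy of the pulled back adjoints becomes relative to `S` by separation, and then
descends to a pointed homotopy on `V`. -/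
theorem injective (h : IsCollapse q S) (hS : Separated X S R) :
    Function.Injective fun x : HClass (Susp V) X => LoopClass.pull q x.toLoops := by
  intro x y hxy
  induction x using Quotient.ind with | _ f =>
  induction y using Quotient.ind with | _ g =>
  refine Quotient.sound (Susp.adj_homotopicRel_iff.1 (h.homotopicRel (hS.inj _ _ ?_ ?_
    (LoopClass.mk_eq_iff.1 hxy))))
  · intro w hw
    rw [ContinuousMap.comp_apply, h.map_mem w hw, Susp.adj_pt]
  · intro w hw
    rw [ContinuousMap.comp_apply, h.map_mem w hw, Susp.adj_pt]

theorem exists_toLoops (h : IsCollapse q S) (hS : Separated X S R) {x : LoopClass W X}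
    (hx : ∀ r ∈ R, LoopClass.pull r x = 1) :
    ∃ ξ : HClass (Susp V) X, LoopClass.pull q ξ.toLoops = x := by
  obtain ⟨f, hf, rfl⟩ := hS.surj x hx
  obtain ⟨g, hg, rfl⟩ := h.exists_comp_eq f hf
  obtain ⟨k, rfl⟩ := Susp.exists_adj g hg
  exact ⟨Quotient.mk _ k, rfl⟩

theorem pull_eq_one (h : IsCollapse q S) (hS : Separated X S R) (ξ : HClass (Susp V) X) :
    ∀ r ∈ R, LoopClass.pull r (LoopClass.pull q ξ.toLoops) = 1 := by
  intro r hr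
  rw [LoopClass.pull_pull, ← ξ.pull_const_toLoops (W := W)]
  congr 2
  ext1 w
  exact h.map_mem _ (hS.mem r hr w)

end IsCollapse

theorem HWellPointed.toLoops_injective {V : PSpace.{u}} (hV : HWellPointed V) (X : PSpace.{v}) :
    Function.Injective (HClass.toLoops : HClass (Susp V) X → LoopClass V X) := fun x y h =>
  (IsCollapse.id V).injective (hV.separated X) (by simpa only [LoopClass.pull_id] using h)

theorem HWellPointed.exists_toLoops {V : PSpace.{u}} (hV : HWellPointed V) {X : PSpace.{v}}
    {x : LoopClass V X} (hx : LoopClass.pull (ContinuousMap.const V V.pt) x = 1) :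
    ∃ ξ : HClass (Susp V) X, ξ.toLoops = x := by
  obtain ⟨ξ, h⟩ := (IsCollapse.id V).exists_toLoops (hV.separated X) (x := x)
    (by rintro _ rfl; exact hx)
  exact ⟨ξ, by simpa only [LoopClass.pull_id] using h⟩

/-! Fox groups -/

namespace Fox

variable {W V : PSpace.{u}} {X : PSpace.{v}}

/-- The inclusion of `W` in `W ⊔ *`. -/
def incl (W : PSpace.{u}) : C(W, addPt W) :=
  ⟨(Sum.inl : W.carrier → W.carrier ⊕ PUnit.{u + 1}), continuous_inl⟩

/-- The function from the Fox group to the classes of maps to the loop space. -/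
def toLoops (ξ : Fox W X) : LoopClass W X := LoopClass.pull (incl W) (HClass.toLoops ξ)

/-- The base point of `W ⊔ *` is isolated, so a free homotopy on `W` extends by the constant loop
and well-pointedness plays no part. -/
theorem toLoops_injective : Function.Injective (toLoops : Fox W X → LoopClass W X) := by
  intro x y hxy
  induction x using Quotient.ind with | _ f =>
  induction y using Quotient.ind with | _ g =>
  refine Quotient.sound (Susp.adj_homotopicRel_iff.1 ?_)
  obtain ⟨H⟩ := LoopClass.mk_eq_iff.1 hxy
  let K : I × (W.carrier ⊕ PUnit.{u + 1}) → Loops X := fun p =>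
    Sum.elim (fun a => H (p.1, a)) (fun _ => Path.refl _) p.2
  have hK : Continuous K := by
    have h : Continuous (K ∘ (Homeomorph.prodSumDistrib (X := I) (Y := W)
        (Z := PUnit.{u + 1})).symm) := by
      rw [continuous_sum_dom]
      exact ⟨H.continuous, continuous_const⟩
    simpa [Function.comp_assoc] using h.comp (Homeomorph.prodSumDistrib (X := I)).continuous
  refine ⟨⟨⟨⟨K, hK⟩, ?_, ?_⟩, ?_⟩⟩
  · rintro (a | ⟨⟩)
    · exact H.apply_zero a
    · exact (Susp.adj_pt f).symm
  · rintro (a | ⟨⟩)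
    · exact H.apply_one a
    · exact (Susp.adj_pt g).symm
  · rintro t _ rfl
    exact (Susp.adj_pt f).symm

theorem toLoops_mul (x y : Fox W X) : toLoops (x * y) = toLoops x * toLoops y := by
  simp only [toLoops, HClass.toLoops_mul, map_mul]

theorem toLoops_inv (x : Fox W X) : toLoops x⁻¹ = (toLoops x)⁻¹ := by
  simp only [toLoops, HClass.toLoops_inv, map_inv]

theorem toLoops_comm (x y : Fox W X) : toLoops (comm x y) = ⁅toLoops x, toLoops y⁆ := by
  simp only [comm, toLoops_mul, toLoops_inv, commutatorElement_def]

theorem toLoops_conj (x y : Fox W X) :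
    toLoops (conj x y) = toLoops y * toLoops x * (toLoops y)⁻¹ := by
  simp only [conj, toLoops_mul, toLoops_inv]

theorem toLoops_one : toLoops (1 : Fox W X) = 1 := rfl

theorem toLoops_image (f : C(W, V)) (ξ : HClass (Susp V) X) :
    toLoops (image f ξ) = LoopClass.pull f ξ.toLoops := by
  induction ξ using Quotient.ind
  rfl

theorem toLoops_pull (f : C(W, V)) (ξ : Fox V X) :
    toLoops (pull f ξ) = LoopClass.pull f (toLoops ξ) := by
  induction ξ using Quotient.ind
  rfl

end Fox

/-! Suspensions that are homotopy co-commutative -/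

namespace kprod3

variable {A B C : PSpace.{u}}

/-- The point of a triple product with the given coordinates. -/
def mk3 (a : A) (b : B) (c : C) : kprod3 A B C := ((a, b), c)

theorem continuous_mk3 {S : Type u} [TopologicalSpace S] [CompactSpace S] [T2Space S] {a : S → A}
    {b : S → B} {c : S → C} (ha : Continuous a) (hb : Continuous b) (hc : Continuous c) :
    Continuous fun s => mk3 (a s) (b s) (c s) :=
  kprod.continuous_ofProd (A := kprod A B) (kprod.continuous_ofProd ha hb) hc

/-- The source has the ordinary product topology and the target the finer k-topology. Currying over
`A` reduces the claim to compact Hausdorff spaces over `A`; here the compact generation of the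
factor is used. -/
theorem continuous_insert [CompactlyGeneratedSpace A] {S : Type u} [TopologicalSpace S]
    [CompactSpace S] [T2Space S] {b : S → B} {c : S → C} (hb : Continuous b) (hc : Continuous c) :
    Continuous fun z : S × A => mk3 z.2 (b z.1) (c z.1) := by
  let G : A → C(S, kprod3 A B C) := fun a =>
    ⟨fun s => mk3 a (b s) (c s), continuous_mk3 continuous_const hb hc⟩
  have hG : Continuous G := by
    refine continuous_from_compactlyGeneratedSpace G fun T _ _ _ a ha => ?_
    refine ContinuousMap.continuous_of_continuous_uncurry _ ?_
    exact continuous_mk3 (S := T × S) (a := fun z => a z.1) (b := fun z => b z.2)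
      (c := fun z => c z.2) (by fun_prop) (by fun_prop) (by fun_prop)
  exact (ContinuousMap.continuous_uncurry_of_continuous ⟨G, hG⟩).comp continuous_swap

variable {V V' D E : PSpace.{u}} {X : PSpace.{v}}

theorem exists_slice [CompactlyGeneratedSpace V'] (φ : PMap V V') {f : C(kprod3 V' D E, Loops X)}
    (hf : ∀ p ∈ {p : kprod3 V' D E | p.1.1 = V'.pt}, f p = Path.refl _) (d : D) (e : E) :
    ∃ g : PMap (Susp V) X, ∀ v, Susp.adj g v = f (mk3 (φ.toMap v) d e) := by
  have hc : Continuous fun v : V => f (mk3 (φ.toMap v) d e) := by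
    have h := continuous_insert (A := V') (B := D) (C := E) (S := PUnit.{u + 1})
      (b := fun _ => d) (c := fun _ => e) continuous_const continuous_const
    exact f.continuous.comp (h.comp (continuous_const.prodMk φ.toMap.continuous :
      Continuous fun v => (PUnit.unit, φ.toMap v)))
  obtain ⟨g, hg⟩ := Susp.exists_adj (V := V) ⟨_, hc⟩ (hf _ φ.map_pt)
  exact ⟨g, fun v => congrArg (fun k : C(V, Loops X) => k v) hg⟩

/-- A restriction of a map of a triple product, as a map of a suspension. -/
def slice [CompactlyGeneratedSpace V'] (φ : PMap V V') {f : C(kprod3 V' D E, Loops X)}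
    (hf : ∀ p ∈ {p : kprod3 V' D E | p.1.1 = V'.pt}, f p = Path.refl _) (d : D) (e : E) :
    PMap (Susp V) X :=
  (exists_slice φ hf d e).choose

theorem adj_slice [CompactlyGeneratedSpace V'] (φ : PMap V V') {f : C(kprod3 V' D E, Loops X)}
    (hf : ∀ p ∈ {p : kprod3 V' D E | p.1.1 = V'.pt}, f p = Path.refl _) (d : D) (e : E) (v : V) :
    Susp.adj (slice φ hf d e) v = f (mk3 (φ.toMap v) d e) :=
  (exists_slice φ hf d e).choose_spec v

theorem continuous_slice [CompactlyGeneratedSpace V'] (φ : PMap V V')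
    {f : C(kprod3 V' D E, Loops X)}
    (hf : ∀ p ∈ {p : kprod3 V' D E | p.1.1 = V'.pt}, f p = Path.refl _) {S : Type u}
    [TopologicalSpace S] [CompactSpace S] [T2Space S] {d : S → D} {e : S → E} (hd : Continuous d)
    (he : Continuous e) :
    Continuous fun z : S × Susp V => (slice φ hf (d z.1) (e z.1)).toMap z.2 := by
  have hq : IsQuotientMap (collapse.mk (cyl V) (suspEnds V)).toMap := isQuotientMap_quot_mk
  refine hq.continuous_lift_prod_right ?_
  have h1 : ∀ z : S × (V × I), (slice φ hf (d z.1) (e z.1)).toMap (Susp.mk z.2.1 z.2.2) =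
      f (mk3 (φ.toMap z.2.1) (d z.1) (e z.1)) z.2.2 := fun z =>
    congrArg (fun p : Loops X => p z.2.2) (adj_slice φ hf (d z.1) (e z.1) z.2.1)
  refine (continuous_congr h1).2 ?_
  have h2 : Continuous fun z : S × (V × I) => f (mk3 (φ.toMap z.2.1) (d z.1) (e z.1)) :=
    f.continuous.comp ((continuous_insert (A := V') hd he).comp
      (by fun_prop : Continuous fun z : S × (V × I) => (z.1, φ.toMap z.2.1)))
  exact h2.eval (by fun_prop)

theorem continuous_desc_slice [CompactlyGeneratedSpace V'] (φ : PMap V V')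
    {f g : C(kprod3 V' D E, Loops X)}
    (hf : ∀ p ∈ {p : kprod3 V' D E | p.1.1 = V'.pt}, f p = Path.refl _)
    (hg : ∀ p ∈ {p : kprod3 V' D E | p.1.1 = V'.pt}, g p = Path.refl _) {S : Type u}
    [TopologicalSpace S] [CompactSpace S] [T2Space S] {d : S → D} {e : S → E} (hd : Continuous d)
    (he : Continuous e) :
    Continuous fun z : S × wedge (Susp V) (Susp V) =>
      (wedge.desc (slice φ hf (d z.1) (e z.1)) (slice φ hg (d z.1) (e z.1))).toMap z.2 := by
  have hq : IsQuotientMap (collapse.mk (psum (Susp V) (Susp V))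
    {x | x = Sum.inl (Susp V).pt ∨ x = Sum.inr (Susp V).pt}).toMap := isQuotientMap_quot_mk
  refine hq.continuous_lift_prod_right ?_
  let H : S × ((Susp V).carrier ⊕ (Susp V).carrier) → X := fun z =>
    Sum.elim (fun x => (slice φ hf (d z.1) (e z.1)).toMap x)
      (fun x => (slice φ hg (d z.1) (e z.1)).toMap x) z.2
  have hH : Continuous H := by
    have h : Continuous (H ∘ (Homeomorph.prodSumDistrib (X := S) (Y := Susp V)
        (Z := Susp V)).symm) := by
      rw [continuous_sum_dom]
      exact ⟨continuous_slice φ hf hd he, continuous_slice φ hg hd he⟩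
    simpa [Function.comp_assoc] using h.comp (Homeomorph.prodSumDistrib (X := S)).continuous
  exact hH

/-- For fixed `(d, e)`, composing the pair of slices of `f` and `g` with the homotopy `T ∘ ν ≃ ν`
interchanges the factors. Two spaces occur because co-commutativity is given on `V`, while the
slices are jointly continuous through the compactly generated model `V'`. -/
theorem mulMap_homotopic_of_coCommutative [CompactlyGeneratedSpace V'] (φ : PMap V V')
    (hV : Susp.CoCommutative V)
    {f g : C(kprod3 V' D E, Loops X)}
    (hf : ∀ p ∈ {p : kprod3 V' D E | p.1.1 = V'.pt}, f p = Path.refl _)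
    (hg : ∀ p ∈ {p : kprod3 V' D E | p.1.1 = V'.pt}, g p = Path.refl _)
    (Φ : C(kprod3 V D E, kprod3 V' D E)) (hΦ : ∀ p, Φ p = mk3 (φ.toMap p.1.1) p.1.2 p.2) :
    (LoopClass.mulMap (g.comp Φ) (f.comp Φ)).Homotopic
      (LoopClass.mulMap (f.comp Φ) (g.comp Φ)) := by
  obtain ⟨K⟩ := hV
  let k : I → PMap (Susp V) (wedge (Susp V) (Susp V)) := fun t =>
    ⟨⟨fun z => K (t, z), K.continuous.comp (Continuous.prodMk_right t)⟩,
      (K.eq_fst t rfl).trans (PMap.map_pt _)⟩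
  let M : kprod3 V D E × I → Loops X := fun z =>
    Susp.adj ((wedge.desc (slice φ hf z.1.1.2 z.1.2) (slice φ hg z.1.1.2 z.1.2)).comp (k z.2))
      z.1.1.1
  have hM : Continuous M := by
    refine kprod3.continuous_of_compact fun S _ _ _ a d e ha hd he => ?_
    refine Path.continuous_uncurry_iff.1 ?_
    have h1 : Continuous fun z : (S × I) × I => Susp.mk (a z.1.1) z.2 :=
      (Susp.continuous_mk V).comp ((ha.comp (continuous_fst.comp continuous_fst)).prodMk
        continuous_snd)
    have h2 : Continuous fun z : (S × I) × I => K (z.1.2, Susp.mk (a z.1.1) z.2) :=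
      K.continuous.comp ((continuous_snd.comp continuous_fst).prodMk h1)
    exact (continuous_desc_slice φ hf hg hd he).comp
      ((continuous_fst.comp continuous_fst).prodMk h2)
  refine ⟨⟨⟨fun z => M (z.2, z.1), hM.comp continuous_swap⟩, fun p => ?_, fun p => ?_⟩⟩
  -- The homotopy starts at `T ∘ ν`, and `(f, g) ∘ T = (g, f)`; hence the product in the opposite
  -- order at time `0`.
  · have h1 : (wedge.desc (slice φ hf p.1.2 p.2) (slice φ hg p.1.2 p.2)).comp (k 0) =
        (wedge.desc (slice φ hg p.1.2 p.2) (slice φ hf p.1.2 p.2)).comp (Susp.comult V) := by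
      have h2 : ∀ z : wedge (Susp V) (Susp V),
          (wedge.desc (slice φ hf p.1.2 p.2) (slice φ hg p.1.2 p.2)).toMap
            ((wedge.swap (Susp V)).toMap z) =
          (wedge.desc (slice φ hg p.1.2 p.2) (slice φ hf p.1.2 p.2)).toMap z := by
        rintro ⟨x | x⟩ <;> rfl
      have h3 : ∀ z : Susp V, (k 0).toMap z = (wedge.swap (Susp V)).toMap
          ((Susp.comult V).toMap z) := fun z => K.apply_zero z
      unfold PMap.comp
      congr 1
      ext1 z
      exact (congrArg _ (h3 z)).trans (h2 _)
    show Susp.adj _ p.1.1 = _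
    rw [h1, Susp.adj_desc_comult]
    show (Susp.adj _ p.1.1).trans (Susp.adj _ p.1.1) = (g (Φ p)).trans (f (Φ p))
    rw [adj_slice, adj_slice, hΦ]
  · have h1 : k 1 = Susp.comult V := by
      have h3 : ∀ z : Susp V, (k 1).toMap z = (Susp.comult V).toMap z := fun z => K.apply_one z
      have h4 : (k 1).toMap = (Susp.comult V).toMap := ContinuousMap.ext h3
      cases hk : k 1
      rw [hk] at h4
      subst h4
      rfl
    show Susp.adj (PMap.comp _ (k 1)) p.1.1 = _
    rw [h1, Susp.adj_desc_comult]
    show (Susp.adj _ p.1.1).trans (Susp.adj _ p.1.1) = (f (Φ p)).trans (g (Φ p))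
    rw [adj_slice, adj_slice, hΦ]

/-- Both classes are moved to `V' × D × E`, where separation for the first face gives
representatives strictly trivial on it; then these are pulled back along `Φ`. -/
theorem commute_of_coCommutative (hV : HasCGHType V) (hc : Susp.CoCommutative V)
    {x y : LoopClass (kprod3 V D E) X} (hx : LoopClass.pull (r1 V D E) x = 1)
    (hy : LoopClass.pull (r1 V D E) y = 1) : Commute x y := by
  obtain ⟨V', -, _, hV', φ, ψ, hψφ, -⟩ := hV
  let Φ : C(kprod3 V D E, kprod3 V' D E) := mapMap φ.toMap (.id _) (.id _)
  let Ψ : C(kprod3 V' D E, kprod3 V D E) := mapMap ψ.toMap (.id _) (.id _)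
  have hΨΦ : (Ψ.comp Φ).Homotopic (.id _) :=
    mapMap_homotopic hψφ.homotopic (.refl (.id _)) (.refl (.id _))
  have key : ∀ z : LoopClass (kprod3 V D E) X, LoopClass.pull (r1 V D E) z = 1 →
      ∃ f : C(kprod3 V' D E, Loops X),
        (∀ p ∈ {p : kprod3 V' D E | p.1.1 = V'.pt}, f p = Path.refl _) ∧
          LoopClass.mk (f.comp Φ) = z := by
    intro z hz
    obtain ⟨f, hf, hfz⟩ := (separated_fst hV'.hWellPointed D E X).surj (LoopClass.pull Ψ z) (by
      rintro _ rfl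
      have h : Ψ.comp (r1 V' D E) = (r1 V D E).comp Ψ := by
        ext1 p
        exact Prod.ext (Prod.ext ψ.map_pt rfl) rfl
      rw [LoopClass.pull_pull, h, ← LoopClass.pull_pull, hz, map_one])
    refine ⟨f, hf, ?_⟩
    rw [← LoopClass.pull_mk, hfz, LoopClass.pull_pull, LoopClass.pull_congr hΨΦ,
      LoopClass.pull_id]
  obtain ⟨f, hf, rfl⟩ := key x hx
  obtain ⟨g, hg, rfl⟩ := key y hy
  exact (LoopClass.mk_eq_iff.2
    (mulMap_homotopic_of_coCommutative φ hc hf hg Φ fun _ => rfl)).symm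

end kprod3

/-! Classes on a space that is split in two -/

namespace LoopClass

variable {W : Type u} [TopologicalSpace W] {X : PSpace.{v}}

/-- The map that agrees with `f` where `χ` is true and is trivial elsewhere. -/
def cutMap (χ : C(W, Bool)) (f : C(W, Loops X)) : C(W, Loops X) where
  toFun w := if χ w then f w else Path.refl _
  continuous_toFun := by
    have h : Continuous fun z : Bool × Loops X => if z.1 then z.2 else Path.refl _ := by
      rw [continuous_prod_of_discrete_left]
      rintro (_ | _)
      · exact continuous_const
      · exact continuous_id
    exact h.comp (χ.continuous.prodMk f.continuous)

theorem cutMap_homotopic (χ : C(W, Bool)) {f g : C(W, Loops X)} (h : f.Homotopic g) :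
    (cutMap χ f).Homotopic (cutMap χ g) := by
  obtain ⟨H⟩ := h
  refine ⟨⟨cutMap (χ.comp ContinuousMap.snd) H.toContinuousMap, fun w => ?_, fun w => ?_⟩⟩
  · show (if χ w then H (0, w) else _) = if χ w then f w else _
    rw [H.apply_zero]
  · show (if χ w then H (1, w) else _) = if χ w then g w else _
    rw [H.apply_one]

/-- The homomorphism that makes a class trivial where `χ` is false. -/
def cut (χ : C(W, Bool)) : LoopClass W X →* LoopClass W X where
  toFun := Quotient.map (cutMap χ) fun _ _ h => cutMap_homotopic χ h
  map_one' := by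
    refine congrArg mk ?_
    ext1 w
    exact ite_self _
  map_mul' := by
    rintro ⟨f⟩ ⟨g⟩
    refine congrArg mk ?_
    ext1 w
    show (if χ w then (f w).trans (g w) else Path.refl _) =
      (if χ w then f w else Path.refl _).trans (if χ w then g w else Path.refl _)
    split_ifs
    · rfl
    · exact Path.refl_trans_refl.symm

theorem cut_mk_congr {χ : C(W, Bool)} {f g : C(W, Loops X)} (h : ∀ w, χ w = true → f w = g w) :
    cut χ (mk f) = cut χ (mk g) := by
  refine congrArg mk ?_
  ext1 w
  show (if χ w then f w else Path.refl _) = (if χ w then g w else Path.refl _)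
  split_ifs with hw
  · exact h w hw
  · rfl

/-- The complement of a map to `Bool`. -/
def compl (χ : C(W, Bool)) : C(W, Bool) := 
  ⟨fun w => !(χ w), (continuous_of_discreteTopology (f := Bool.not)).comp χ.continuous⟩

/-- The two pieces are open and closed, so the homotopies on them glue. -/
theorem ext_cut (χ : C(W, Bool)) {x y : LoopClass W X} (h : cut χ x = cut χ y)
    (h' : cut (compl χ) x = cut (compl χ) y) : x = y := by
  induction x using ind with | h f =>
  induction y using ind with | h g =>
  obtain ⟨H⟩ := mk_eq_iff.1 h
  obtain ⟨H'⟩ := mk_eq_iff.1 h'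
  have hc : Continuous fun z : Bool × Loops X × Loops X => if z.1 then z.2.1 else z.2.2 := by
    rw [continuous_prod_of_discrete_left]
    rintro (_ | _)
    · exact continuous_snd
    · exact continuous_fst
  refine mk_eq_iff.2 ⟨⟨⟨fun z => if χ z.2 then H z else H' z,
    hc.comp ((χ.continuous.comp continuous_snd).prodMk (H.continuous.prodMk H'.continuous))⟩,
    fun w => ?_, fun w => ?_⟩⟩
  · show (if χ w then H (0, w) else H' (0, w)) = f w
    rw [H.apply_zero, H'.apply_zero]
    cases hw : χ w <;> simp [cutMap, compl, hw]
  · show (if χ w then H (1, w) else H' (1, w)) = g w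
    rw [H.apply_one, H'.apply_one]
    cases hw : χ w <;> simp [cutMap, compl, hw]

end LoopClass

/-! ### Conjugation when one factor is equivalent to `S⁰` -/

theorem kprod3.conj_eq_of_isHEquiv {V D E : PSpace.{u}} {X : PSpace.{v}} {s : PMap S0.{u} V}
    (hs : IsHEquiv s) (ξ : HClass (Susp V) X) {y : LoopClass (kprod3 V D E) X}
    (hy : LoopClass.pull (kprod3.r1 V D E) y = 1) :
    LoopClass.pull (kprod3.p1 V D E).toMap ξ.toLoops * y *
        (LoopClass.pull (kprod3.p1 V D E).toMap ξ.toLoops)⁻¹ =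
      LoopClass.pull (ContinuousMap.const _ (s.toMap (ULift.up true))) ξ.toLoops * y *
        (LoopClass.pull (ContinuousMap.const _ (s.toMap (ULift.up true))) ξ.toLoops)⁻¹ := by
  obtain ⟨e, -, hse⟩ := hs
  have hse' : ContinuousMap.Homotopic (s.toMap.comp e.toMap) (.id V) := hse.homotopic
  let χ : C(kprod3 V D E, Bool) :=
    ⟨fun p => ULift.down (e.toMap p.1.1 : ULift.{u} Bool), by
      have h : Continuous fun x : S0.{u} => ULift.down (show ULift.{u} Bool from x) :=
        continuous_bot
      exact h.comp (e.toMap.continuous.comp (kprod3.p1 V D E).toMap.continuous)⟩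
  -- Over the point of `S⁰` other than the base point, the first coordinate may be replaced by `s ∘
  -- e`, which is constant there; the two conjugating classes agree.
  have hb : LoopClass.cut χ (LoopClass.pull (kprod3.p1 V D E).toMap ξ.toLoops) =
      LoopClass.cut χ (LoopClass.pull
        (ContinuousMap.const _ (s.toMap (ULift.up true))) ξ.toLoops) := by
    have h1 : LoopClass.pull (kprod3.p1 V D E).toMap ξ.toLoops =
        LoopClass.pull ((s.toMap.comp e.toMap).comp (kprod3.p1 V D E).toMap) ξ.toLoops :=
      LoopClass.pull_congr (.comp hse'.symm (.refl (kprod3.p1 V D E).toMap)) _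
    rw [h1]
    induction ξ using Quotient.ind with | _ k =>
    refine LoopClass.cut_mk_congr fun p hp => ?_
    have hp' : e.toMap p.1.1 = (ULift.up true : ULift.{u} Bool) := ULift.ext _ _ hp
    show Susp.adj k (s.toMap (e.toMap p.1.1)) = Susp.adj k (s.toMap (ULift.up true))
    rw [hp']
  -- Over the base point of `S⁰`, `ρ` coincides with `r1`, which kills `y`, and `ρ` is homotopic to
  -- the identity. So there both conjugates are trivial, whatever the conjugating classes.
  have hy' : LoopClass.cut (LoopClass.compl χ) y = 1 := by
    let ρ : C(kprod3 V D E, kprod3 V D E) :=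
      mapMap (s.toMap.comp e.toMap) (.id _) (.id _)
    have hρ : ρ.Homotopic (.id _) := mapMap_homotopic hse' (.refl (.id _)) (.refl (.id _))
    rw [← LoopClass.pull_id y, ← LoopClass.pull_congr hρ, ← map_one (LoopClass.cut _), ← hy]
    induction y using LoopClass.ind with | h f =>
    refine LoopClass.cut_mk_congr fun p hp => ?_
    have hp' : e.toMap p.1.1 = S0.pt := by
      refine ULift.ext _ _ ?_
      have h : (!(χ p)) = true := hp
      exact Bool.not_eq_true' _ ▸ h
    have h : ρ p = r1 V D E p :=
      Prod.ext (Prod.ext ((congrArg s.toMap hp').trans s.map_pt) rfl) rfl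
    exact congrArg f h
  refine LoopClass.ext_cut χ ?_ ?_
  · simp only [map_mul, map_inv, hb]
  · simp only [map_mul, map_inv, hy', mul_one, mul_inv_cancel]

/-! Existence and uniqueness of generalized Whitehead products -/

section Products

variable {A B C : PSpace.{u}} {X : PSpace.{v}}

theorem isGWP_iff (hA : HWellPointed A) (hB : HWellPointed B) {ξ : HClass (Susp A) X}
    {η : HClass (Susp B) X} {κ : HClass (Susp (smash A B)) X} :
    IsGWP ξ η κ ↔ LoopClass.pull (smash.proj A B).toMap κ.toLoops =
      ⁅LoopClass.pull (kprod.fst A B).toMap ξ.toLoops,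
        LoopClass.pull (kprod.snd A B).toMap η.toLoops⁆ := by
  rw [IsGWP, ← ((hA.kprod hB).toLoops_injective X).eq_iff]
  simp only [HClass.toLoops_comm, HClass.toLoops_pull]

/-- On each axis one entry of the commutator is trivial, so the commutator satisfies the condition
for coming from the smash product; uniqueness is injectivity of the pull-back. -/
theorem existsUnique_isGWP (hA : HWellPointed A) (hB : HWellPointed B) (ξ : HClass (Susp A) X)
    (η : HClass (Susp B) X) : ∃! κ, IsGWP ξ η κ := by
  simp only [isGWP_iff hA hB]
  have hq := IsCollapse.collapse (W := kprod A B) (S := {p | p.1 = A.pt ∨ p.2 = B.pt}) (Or.inl rfl)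
  have hS := kprod.separated hA hB X
  refine existsUnique_of_exists_of_unique (hq.exists_toLoops hS ?_)
    fun x y hx hy => hq.injective hS (hx.trans hy.symm)
  rintro _ (rfl | rfl)
  · rw [map_commutatorElement, LoopClass.pull_pull, LoopClass.pull_pull]
    have h := η.pull_const_toLoops (W := kprod A B)
    erw [h]
    exact commutatorElement_one_right _
  · rw [map_commutatorElement, LoopClass.pull_pull, LoopClass.pull_pull]
    have h := ξ.pull_const_toLoops (W := kprod A B)
    erw [h]
    exact commutatorElement_one_left _

theorem pull_gwp (hA : HWellPointed A) (hB : HWellPointed B) (ξ : HClass (Susp A) X)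
    (η : HClass (Susp B) X) :
    LoopClass.pull (smash.proj A B).toMap (gwp ξ η).toLoops =
      ⁅LoopClass.pull (kprod.fst A B).toMap ξ.toLoops,
        LoopClass.pull (kprod.snd A B).toMap η.toLoops⁆ :=
  (isGWP_iff hA hB).1 (Classical.epsilon_spec (existsUnique_isGWP hA hB ξ η).exists)

/-- The image of a class of maps of `Σ(A ∧ B ∧ C)` in the classes of maps of `A × B × C` to the
loop space. -/
def smash3.toLoops (η : HClass (Susp (smash3 A B C)) X) : LoopClass (kprod3 A B C) X :=
  LoopClass.pull (smash3.proj A B C).toMap η.toLoops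

namespace smash3

theorem toLoops_injective (hA : HWellPointed A) (hB : HWellPointed B) (hC : HWellPointed C)
    (X : PSpace.{v}) :
    Function.Injective (toLoops : HClass (Susp (smash3 A B C)) X → LoopClass (kprod3 A B C) X) :=
  (IsCollapse.collapse (W := kprod3 A B C) (Or.inl rfl)).injective (kprod3.separated hA hB hC X)

theorem pull_r1_toLoops (hA : HWellPointed A) (hB : HWellPointed B) (hC : HWellPointed C)
    (η : HClass (Susp (smash3 A B C)) X) : LoopClass.pull (kprod3.r1 A B C) (toLoops η) = 1 :=
  (IsCollapse.collapse (W := kprod3 A B C) (Or.inl rfl)).pull_eq_one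
    (kprod3.separated hA hB hC X) η _ (by simp)

theorem toLoops_mul (x y : HClass (Susp (smash3 A B C)) X) :
    toLoops (x * y) = toLoops x * toLoops y := by
  simp only [toLoops, HClass.toLoops_mul, map_mul]

theorem toLoops_pull_map {D E F : PSpace.{u}} (t : PMap (kprod3 A B C) (kprod3 D E F))
    (ht : ∀ x ∈ fatWedge A B C, t.toMap x ∈ fatWedge D E F)
    (η : HClass (Susp (smash3 D E F)) X) :
    toLoops (η.pull (Susp.map (map t ht))) = LoopClass.pull t.toMap (toLoops η) := by
  unfold toLoops
  rw [HClass.toLoops_pull, LoopClass.pull_pull, LoopClass.pull_pull]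
  rfl

/-- The outer defining equation is pulled back along `m : A × B × C → (A ∧ B) × C`, the inner one
along the projection to `A × B`. -/
theorem toLoops_gwp3 (hA : HWellPointed A) (hB : HWellPointed B) (hC : HWellPointed C)
    (ξ : HClass (Susp A) X) (η : HClass (Susp B) X) (ζ : HClass (Susp C) X) :
    toLoops (gwp3 ξ η ζ) =
      ⁅⁅LoopClass.pull (kprod3.p1 A B C).toMap ξ.toLoops,
        LoopClass.pull (kprod3.p2 A B C).toMap η.toLoops⁆,
        LoopClass.pull (kprod3.p3 A B C).toMap ζ.toLoops⁆ := by
  let m : PMap (kprod3 A B C) (kprod (smash A B) C) :=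
    kprod.pair ((smash.proj A B).comp (kprod.fst (kprod A B) C)) (kprod.snd (kprod A B) C)
  have h1 : toLoops (gwp3 ξ η ζ) = LoopClass.pull m.toMap
      (LoopClass.pull (smash.proj (smash A B) C).toMap (gwp (gwp ξ η) ζ).toLoops) := by
    rw [toLoops, gwp3, HClass.toLoops_pull, LoopClass.pull_pull, LoopClass.pull_pull]
    rfl
  have h2 : LoopClass.pull m.toMap (LoopClass.pull (kprod.fst (smash A B) C).toMap
      (gwp ξ η).toLoops) = LoopClass.pull (kprod.fst (kprod A B) C).toMap
        (LoopClass.pull (smash.proj A B).toMap (gwp ξ η).toLoops) := by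
    rw [LoopClass.pull_pull, LoopClass.pull_pull]
    rfl
  rw [h1, pull_gwp (hA.smash hB) hC, map_commutatorElement, h2, pull_gwp hA hB,
    map_commutatorElement, LoopClass.pull_pull, LoopClass.pull_pull, LoopClass.pull_pull]
  rfl

/-- The image of an iterated product under a map of triple products. -/
theorem pull_toLoops_gwp3 {D E F : PSpace.{u}} (t : PMap (kprod3 A B C) (kprod3 D E F))
    (hD : HWellPointed D) (hE : HWellPointed E) (hF : HWellPointed F)
    (ξ : HClass (Susp D) X) (η : HClass (Susp E) X) (ζ : HClass (Susp F) X) :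
    LoopClass.pull t.toMap (toLoops (gwp3 ξ η ζ)) =
      ⁅⁅LoopClass.pull ((kprod3.p1 D E F).comp t).toMap ξ.toLoops,
        LoopClass.pull ((kprod3.p2 D E F).comp t).toMap η.toLoops⁆,
        LoopClass.pull ((kprod3.p3 D E F).comp t).toMap ζ.toLoops⁆ := by
  rw [toLoops_gwp3 hD hE hF]
  simp only [map_commutatorElement, LoopClass.pull_pull]
  rfl

end smash3

end Products

/-! The action of the fundamental group -/

section Action

/-- The point of `S⁰` other than the base point. -/
def S0.other : S0.{u} := (ULift.up true : ULift.{u} Bool)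

variable {W : PSpace.{u}} {X : PSpace.{v}}

theorem isAction_iff {ω : HClass (Susp S0.{u}) X} {η θ : HClass (Susp W) X} :
    IsAction ω η θ ↔ θ.toLoops =
      LoopClass.pull (ContinuousMap.const W S0.other) ω.toLoops * η.toLoops *
        (LoopClass.pull (ContinuousMap.const W S0.other) ω.toLoops)⁻¹ := by
  rw [IsAction, ← Fox.toLoops_injective.eq_iff, Fox.toLoops_conj, piOneImage]
  simp only [Fox.toLoops_image, LoopClass.pull_id]
  rfl

/-- Pointed classes are exactly the free classes that vanish at the base point, a condition stable
under conjugation. -/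
theorem existsUnique_isAction (hW : HWellPointed W) (ω : HClass (Susp S0.{u}) X)
    (η : HClass (Susp W) X) : ∃! θ, IsAction ω η θ := by
  simp only [isAction_iff]
  refine existsUnique_of_exists_of_unique (hW.exists_toLoops ?_)
    fun x y hx hy => hW.toLoops_injective X (hx.trans hy.symm)
  rw [map_mul, map_mul, η.pull_const_toLoops, mul_one, map_inv, mul_inv_cancel]

theorem toLoops_action (hW : HWellPointed W) (ω : HClass (Susp S0.{u}) X)
    (η : HClass (Susp W) X) : (action ω η).toLoops =
      LoopClass.pull (ContinuousMap.const W S0.other) ω.toLoops * η.toLoops *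
        (LoopClass.pull (ContinuousMap.const W S0.other) ω.toLoops)⁻¹ :=
  isAction_iff.1 (Classical.epsilon_spec (existsUnique_isAction hW ω η).exists)

end Action

/-! ### Commutator calculus in the group of the triple product -/

/-- One formula for both cases of `dot`: the action of a loop is a conjugation, and in the
co-commutative case the two classes commute because both vanish on the first face. -/
theorem smash3.toLoops_dot {A B C : PSpace.{u}} {X : PSpace.{v}} (hA : HasCGHType A)
    (hB : HWellPointed B) (hC : HWellPointed C)
    (h : Susp.CoCommutative A ∨ ∃ s : PMap S0.{u} A, IsHEquiv s) (ξ : HClass (Susp A) X)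
    (η : HClass (Susp (smash3 A B C)) X) :
    smash3.toLoops (dot ξ η) = LoopClass.pull (kprod3.p1 A B C).toMap ξ.toLoops *
      smash3.toLoops η * (LoopClass.pull (kprod3.p1 A B C).toMap ξ.toLoops)⁻¹ := by
  have hη := smash3.pull_r1_toLoops hA.hWellPointed hB hC η
  unfold dot
  split_ifs with hs
  · rw [kprod3.conj_eq_of_isHEquiv hs.choose_spec ξ hη, smash3.toLoops,
      toLoops_action (hA.hWellPointed.smash3 hB hC), HClass.toLoops_pull, map_mul, map_mul, map_inv,
      LoopClass.pull_pull, LoopClass.pull_pull]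
    rfl
  · have hξ : LoopClass.pull (kprod3.r1 A B C)
        (LoopClass.pull (kprod3.p1 A B C).toMap ξ.toLoops) = 1 := by
      rw [LoopClass.pull_pull]
      exact ξ.pull_const_toLoops (W := kprod3 A B C)
    rw [(kprod3.commute_of_coCommutative hA (h.resolve_right hs) hξ hη).eq, mul_inv_cancel_right]

theorem hall_witt {G : Type*} [Group G] (a b c : G) :
    b * ⁅⁅b⁻¹, a⁆, c⁆ * b⁻¹ * (c * ⁅⁅c⁻¹, b⁆, a⁆ * c⁻¹) * (a * ⁅⁅a⁻¹, c⁆, b⁆ * a⁻¹) = 1 := by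
  simp only [commutatorElement_def]
  group

/-- If `ΣA` is homotopy co-commutative, inverses and conjugations disappear from the iterated
commutators of the identity of Hall and Witt. -/
theorem conj_commutator_of_coCommutative {A B C : PSpace.{u}} {X : PSpace.{v}}
    (hA : HasCGHType A) (hc : Susp.CoCommutative A) (ξ : HClass (Susp A) X)
    (b c : LoopClass (kprod3 A B C) X) {a : LoopClass (kprod3 A B C) X}
    (ha : a = LoopClass.pull (kprod3.p1 A B C).toMap ξ.toLoops) :
    a * ⁅⁅a⁻¹, b⁆, c⁆ * a⁻¹ = ⁅⁅b, a⁆, c⁆ := by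
  have h1 : LoopClass.pull (kprod3.r1 A B C) a = 1 := by
    rw [ha, LoopClass.pull_pull]
    exact ξ.pull_const_toLoops (W := kprod3 A B C)
  have hba : LoopClass.pull (kprod3.r1 A B C) ⁅b, a⁆ = 1 := by
    rw [map_commutatorElement, h1, commutatorElement_one_right]
  have hbac : LoopClass.pull (kprod3.r1 A B C) ⁅⁅b, a⁆, c⁆ = 1 := by
    rw [map_commutatorElement, hba, commutatorElement_one_left]
  -- The inverse inside the commutator costs only a conjugation by `a`, which `h3` removes; `h4`
  -- removes the outer conjugation.
  have h2 : a⁻¹ * ⁅b, a⁆ * a = ⁅a⁻¹, b⁆ := by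
    simp only [commutatorElement_def]
    group
  have h3 := kprod3.commute_of_coCommutative hA hc h1 hba
  have h4 := kprod3.commute_of_coCommutative hA hc h1 hbac
  rw [← h2, mul_assoc a⁻¹, ← h3.eq, inv_mul_cancel_left, h4.eq, mul_inv_cancel_right]

/-! The Jacobi identities -/

section Identities

variable {A B C : PSpace.{u}} {X : PSpace.{v}}

theorem fox_commutators (hA : HWellPointed A) (hB : HWellPointed B) (hC : HWellPointed C)
    (α : HClass (Susp A) X) (β : HClass (Susp B) X) (γ : HClass (Susp C) X) :
    Fox.pull (kprod3.t213 A B C).toMap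
        (Fox.image (smash3.proj B A C).toMap (gwp3 β⁻¹ α γ)) =
      comm (comm (Fox.image (kprod3.p2 A B C).toMap β)⁻¹ (Fox.image (kprod3.p1 A B C).toMap α))
        (Fox.image (kprod3.p3 A B C).toMap γ) ∧
    Fox.pull (kprod3.t321 A B C).toMap
        (Fox.image (smash3.proj C B A).toMap (gwp3 γ⁻¹ β α)) =
      comm (comm (Fox.image (kprod3.p3 A B C).toMap γ)⁻¹ (Fox.image (kprod3.p2 A B C).toMap β))
        (Fox.image (kprod3.p1 A B C).toMap α) ∧
    Fox.pull (kprod3.t132 A B C).toMap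
        (Fox.image (smash3.proj A C B).toMap (gwp3 α⁻¹ γ β)) =
      comm (comm (Fox.image (kprod3.p1 A B C).toMap α)⁻¹ (Fox.image (kprod3.p3 A B C).toMap γ))
        (Fox.image (kprod3.p2 A B C).toMap β) := by
  refine ⟨?_, ?_, ?_⟩ <;> apply Fox.toLoops_injective <;>
    simp only [Fox.toLoops_comm, Fox.toLoops_inv, Fox.toLoops_pull, Fox.toLoops_image]
  · refine (smash3.pull_toLoops_gwp3 _ hB hA hC _ _ _).trans ?_
    rw [HClass.toLoops_inv, map_inv]
    rfl
  · refine (smash3.pull_toLoops_gwp3 _ hC hB hA _ _ _).trans ?_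
    rw [HClass.toLoops_inv, map_inv]
    rfl
  · refine (smash3.pull_toLoops_gwp3 _ hA hC hB _ _ _).trans ?_
    rw [HClass.toLoops_inv, map_inv]
    rfl

/-- The group laws are borrowed from `LoopClass W X` through an injection that respects the
operations. -/
theorem fox_hall_witt {W : PSpace.{u}} (a b c : Fox W X) :
    conj (comm (comm b⁻¹ a) c) b * conj (comm (comm c⁻¹ b) a) c *
      conj (comm (comm a⁻¹ c) b) a = 1 := by
  apply Fox.toLoops_injective
  simp only [Fox.toLoops_mul, Fox.toLoops_conj, Fox.toLoops_comm, Fox.toLoops_inv,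
    Fox.toLoops_one]
  exact hall_witt _ _ _

/-- Hall–Witt without its conjugations yields the three commutators with the last two interchanged;
these two commute, as both contain `a` and so vanish on the first face. -/
theorem jacobi_of_coCommutative (hA : HasCGHType A) (hB : HasCGHType B) (hC : HasCGHType C)
    (cA : Susp.CoCommutative A) (cB : Susp.CoCommutative B) (cC : Susp.CoCommutative C)
    (α : HClass (Susp A) X) (β : HClass (Susp B) X) (γ : HClass (Susp C) X) :
    gwp3 α β γ * (gwp3 γ α β).pull (Susp.map (smash3.t312 A B C)) *
      (gwp3 β γ α).pull (Susp.map (smash3.t231 A B C)) = 1 := by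
  have wA := hA.hWellPointed
  have wB := hB.hWellPointed
  have wC := hC.hWellPointed
  apply smash3.toLoops_injective wA wB wC
  unfold smash3.t312 smash3.t231
  rw [smash3.toLoops_mul, smash3.toLoops_mul, smash3.toLoops_pull_map, smash3.toLoops_pull_map,
    smash3.toLoops_gwp3 wA wB wC, smash3.pull_toLoops_gwp3 _ wC wA wB,
    smash3.pull_toLoops_gwp3 _ wB wC wA]
  let a := LoopClass.pull (kprod3.p1 A B C).toMap α.toLoops
  let b := LoopClass.pull (kprod3.p2 A B C).toMap β.toLoops
  let c := LoopClass.pull (kprod3.p3 A B C).toMap γ.toLoops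
  show ⁅⁅a, b⁆, c⁆ * ⁅⁅c, a⁆, b⁆ * ⁅⁅b, c⁆, a⁆ = 1
  -- The lemma concerns the first factor of a product, so it is applied on `B × A × C` and pulled
  -- back along the twist.
  have h1 : b * ⁅⁅b⁻¹, a⁆, c⁆ * b⁻¹ = ⁅⁅a, b⁆, c⁆ := by
    have h := congrArg (LoopClass.pull (kprod3.t213 A B C).toMap)
      (conj_commutator_of_coCommutative hB cB β
        (LoopClass.pull (kprod3.p2 B A C).toMap α.toLoops)
        (LoopClass.pull (kprod3.p3 B A C).toMap γ.toLoops) rfl)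
    simp only [map_mul, map_inv, map_commutatorElement, LoopClass.pull_pull] at h
    exact h
  have h2 : c * ⁅⁅c⁻¹, b⁆, a⁆ * c⁻¹ = ⁅⁅b, c⁆, a⁆ := by
    have h := congrArg (LoopClass.pull (kprod3.t321 A B C).toMap)
      (conj_commutator_of_coCommutative hC cC γ
        (LoopClass.pull (kprod3.p2 C B A).toMap β.toLoops)
        (LoopClass.pull (kprod3.p3 C B A).toMap α.toLoops) rfl)
    simp only [map_mul, map_inv, map_commutatorElement, LoopClass.pull_pull] at h
    exact h
  have h3 : a * ⁅⁅a⁻¹, c⁆, b⁆ * a⁻¹ = ⁅⁅c, a⁆, b⁆ :=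
    conj_commutator_of_coCommutative hA cA α c b rfl
  have ha : LoopClass.pull (kprod3.r1 A B C) a = 1 := by
    rw [LoopClass.pull_pull]
    exact α.pull_const_toLoops (W := kprod3 A B C)
  have h4 : Commute ⁅⁅c, a⁆, b⁆ ⁅⁅b, c⁆, a⁆ :=
    kprod3.commute_of_coCommutative hA cA
      (by simp only [map_commutatorElement, ha, commutatorElement_one_right,
        commutatorElement_one_left])
      (by simp only [map_commutatorElement, ha, commutatorElement_one_right])
  have h := hall_witt a b c
  rw [h1, h2, h3] at h
  rw [mul_assoc, h4.eq, ← mul_assoc, h]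

theorem jacobi_dot (hA : HasCGHType A) (hB : HasCGHType B) (hC : HasCGHType C)
    (cA : Susp.CoCommutative A ∨ ∃ s : PMap S0.{u} A, IsHEquiv s)
    (cB : Susp.CoCommutative B ∨ ∃ s : PMap S0.{u} B, IsHEquiv s)
    (cC : Susp.CoCommutative C ∨ ∃ s : PMap S0.{u} C, IsHEquiv s)
    (α : HClass (Susp A) X) (β : HClass (Susp B) X) (γ : HClass (Susp C) X) :
    (dot β (gwp3 β⁻¹ α γ)).pull (Susp.map (smash3.t213 A B C)) *
      (dot γ (gwp3 γ⁻¹ β α)).pull (Susp.map (smash3.t321 A B C)) *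
      (dot α (gwp3 α⁻¹ γ β)).pull (Susp.map (smash3.t132 A B C)) = 1 := by
  have wA := hA.hWellPointed
  have wB := hB.hWellPointed
  have wC := hC.hWellPointed
  apply smash3.toLoops_injective wA wB wC
  unfold smash3.t213 smash3.t321 smash3.t132
  rw [smash3.toLoops_mul, smash3.toLoops_mul, smash3.toLoops_pull_map, smash3.toLoops_pull_map,
    smash3.toLoops_pull_map, smash3.toLoops_dot hB wA wC cB, smash3.toLoops_dot hC wB wA cC,
    smash3.toLoops_dot hA wC wB cA]
  simp only [map_mul, map_inv]
  rw [smash3.pull_toLoops_gwp3 _ wB wA wC, smash3.pull_toLoops_gwp3 _ wC wB wA,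
    smash3.pull_toLoops_gwp3 _ wA wC wB]
  simp only [HClass.toLoops_inv, map_inv, LoopClass.pull_pull]
  exact hall_witt (LoopClass.pull (kprod3.p1 A B C).toMap α.toLoops)
    (LoopClass.pull (kprod3.p2 A B C).toMap β.toLoops)
    (LoopClass.pull (kprod3.p3 A B C).toMap γ.toLoops)

end Identities

end Jacobi

end

/-! ### The theorem -/

open Jacobi in
theorem theorem3 (A B C : PSpace.{u}) (X : PSpace.{v})
    (hA : HasCGHType A) (hB : HasCGHType B) (hC : HasCGHType C)
    (α : HClass (Susp A) X) (β : HClass (Susp B) X) (γ : HClass (Susp C) X) :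
    -- the products and the action in the statement are well defined
    ((∃! κ, IsGWP α β κ) ∧ (∀ κ : HClass (Susp (smash A B)) X, ∃! μ, IsGWP κ γ μ) ∧
      (∀ (ω : HClass (Susp S0.{u}) X) (η : HClass (Susp (smash3 A B C)) X),
        ∃! θ, IsAction ω η θ)) ∧
    -- (1)
    (∀ a b c : Fox (kprod3 A B C) X,
      a = Fox.image (kprod3.p1 A B C).toMap α →
      b = Fox.image (kprod3.p2 A B C).toMap β →
      c = Fox.image (kprod3.p3 A B C).toMap γ →
      Fox.pull (kprod3.t213 A B C).toMap
          (Fox.image (smash3.proj B A C).toMap (gwp3 β⁻¹ α γ)) = comm (comm b⁻¹ a) c ∧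
      Fox.pull (kprod3.t321 A B C).toMap
          (Fox.image (smash3.proj C B A).toMap (gwp3 γ⁻¹ β α)) = comm (comm c⁻¹ b) a ∧
      Fox.pull (kprod3.t132 A B C).toMap
          (Fox.image (smash3.proj A C B).toMap (gwp3 α⁻¹ γ β)) = comm (comm a⁻¹ c) b ∧
      conj (Fox.pull (kprod3.t213 A B C).toMap
          (Fox.image (smash3.proj B A C).toMap (gwp3 β⁻¹ α γ))) b *
        conj (Fox.pull (kprod3.t321 A B C).toMap
          (Fox.image (smash3.proj C B A).toMap (gwp3 γ⁻¹ β α))) c *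
        conj (Fox.pull (kprod3.t132 A B C).toMap
          (Fox.image (smash3.proj A C B).toMap (gwp3 α⁻¹ γ β))) a = 1) ∧
    -- (2)
    (Susp.CoCommutative A → Susp.CoCommutative B → Susp.CoCommutative C →
      gwp3 α β γ *
        (gwp3 γ α β).pull (Susp.map (smash3.t312 A B C)) *
        (gwp3 β γ α).pull (Susp.map (smash3.t231 A B C)) = 1) ∧
    -- (3)
    ((Susp.CoCommutative A ∨ ∃ s : PMap S0.{u} A, IsHEquiv s) →
      (Susp.CoCommutative B ∨ ∃ s : PMap S0.{u} B, IsHEquiv s) →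
      (Susp.CoCommutative C ∨ ∃ s : PMap S0.{u} C, IsHEquiv s) →
      (dot β (gwp3 β⁻¹ α γ)).pull (Susp.map (smash3.t213 A B C)) *
        (dot γ (gwp3 γ⁻¹ β α)).pull (Susp.map (smash3.t321 A B C)) *
        (dot α (gwp3 α⁻¹ γ β)).pull (Susp.map (smash3.t132 A B C)) = 1) := by
  have wA := hA.hWellPointed
  have wB := hB.hWellPointed
  have wC := hC.hWellPointed
  refine ⟨⟨existsUnique_isGWP wA wB α β, fun κ => existsUnique_isGWP (wA.smash wB) wC κ γ,
    existsUnique_isAction (wA.smash3 wB wC)⟩, ?_, fun cA cB cC =>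
      jacobi_of_coCommutative hA hB hC cA cB cC α β γ, fun cA cB cC =>
      jacobi_dot hA hB hC cA cB cC α β γ⟩
  rintro a b c rfl rfl rfl
  obtain ⟨h1, h2, h3⟩ := fox_commutators wA wB wC α β γ
  refine ⟨h1, h2, h3, ?_⟩
  rw [h1, h2, h3]
  exact fox_hall_witt _ _ _
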